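/- For an operator algebra $A$ (a subalgebra of a C*-algebra, with the inherited norms on all $M_k(A)$), the maximal C*-cover $C^*_{\max}(A)$ is the C*-algebra generated by a completely isometric homomorphic copy $j(A)$ of $A$ such that every completely contractive homomorphism of $A$ into a C*-algebra extends to a $*$-homomorphism of $C^*_{\max}(A)$ into the same C*-algebra. For C*-algebras $C_1,\dots,C_m$ that contain a common C*-subalgebra $D$, the amalgamated free product $C_1 *_D\cdots *_D C_m$ is the C*-algebra generated by copies of $C_1,\dots,C_m$ in which the copies of $D$ are identified, such that any $*$-homomorphisms of the $C_i$ into a C*-algebra that agree on $D$ extend to a $*$-homomorphism of $C_1 *_D\cdots *_D C_m$. Let $E_{r,s}$ be the matrix units of $M_n(\mathbb C)$, $D_n=\operatorname{span}\{E_{1,1},\dots,E_{n,n}\}$ the diagonal matrices, and $T_n$ the upper triangular matrices. For $1\le i\le n-1$ let $A_i=D_n+\mathbb C E_{i,i+1}=\mathbb C^{i-1}\oplus T_2\oplus\mathbb C^{n-i-1}$, and let $A_n=D_n+\mathbb C E_{n,1}$, all as subalgebras of $M_n(\mathbb C)$. Let $C_n$ be the directed $n$-cycle with vertices $v_1,\dots,v_n$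 and edges $e_i$ from $v_i$ to $v_{i+1}$ ($1\le i\le n-1$) and $e_n$ from $v_n$ to $v_1$, and let $A(C_n)$ be its operator algebra: the norm-closed algebra of operators on $\ell^2$ of the set of finite paths of $C_n$ (with orthonormal basis $(\xi_w)$) generated by the projections $P_k$ onto $\overline{\operatorname{span}}\{\xi_w : w \text{ starts at } v_k\}$ and the creation operators $L_{e}$, where $L_{e}\xi_w=\xi_{ew}$ if $w$ starts at the end of $e$, and $L_e\xi_w=0$ otherwise. **Theorem.** (1) For $n\ge 3$, $$C^*_{\max}(T_n)\cong C^*_{\max}(A_1) *_{D_n} C^*_{\max}(A_2) *_{D_n}\cdots *_{D_n} C^*_{\max}(A_{n-1}),$$ by a $*$-isomorphism that carries the copy of each $a\in A_i$ in the free product to the copy of $a\in A_i\subseteq T_n$ in $C^*_{\max}(T_n)$. (2) For $n\ge 2$, $$C^*_{\max}(A(C_n))\cong C^*_{\max}(A_1) *_{D_n} C^*_{\max}(A_2) *_{D_n}\cdots *_{D_n} C^*_{\max}(A_{n-1}) *_{D_n} C^*_{\max}(A_n),$$ by a $*$-isomorphism that, for each $i$, carries the copies of $E_{k,k}\in A_i$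 ($1\le k\le n$) to the copies of $P_k$, and the copy of $E_{i,i+1}\in A_i$ (of $E_{n,1}\in A_n$ if $i=n$) to the copy of $L_{e_i}$. -/

import Mathlib

open scoped Matrix.Norms.L2Operator ENNReal

noncomputable section

universe u v w

/-! ### Universal C*-algebras -/

/-- A class of representations of a set `G` of generators: maps of `G` into C*-algebras which are
bounded at each generator, uniformly over the class. -/
structure CStarRelations (G : Type u) where
  holds : ∀ (X : Type u) [NonUnitalCStarAlgebra X], (G → X) → Prop
  bound : G → ℝ
  norm_le : ∀ (X : Type u) [NonUnitalCStarAlgebra X] (f : G → X), holds X f →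
    ∀ g, ‖f g‖ ≤ bound g

/-- The free (non-unital) *-algebra on `G`, as an algebra: noncommutative polynomials without
constant term in the letters `g` and `g*`. -/
abbrev StarPoly (G : Type u) : Type u := MonoidAlgebra ℂ (FreeSemigroup (G ⊕ G))

/-- Evaluation of *-polynomials at a family `f` of elements of a C*-algebra. -/
def StarPoly.eval {G : Type u} {X : Type v} [NonUnitalCStarAlgebra X] (f : G → X) :
    StarPoly G →ₙₐ[ℂ] X :=
  MonoidAlgebra.liftMagma ℂ (FreeSemigroup.lift (Sum.elim f fun g => star (f g)))

theorem StarPoly.eval_comp {G : Type u} {X : Type v} {Y : Type w} [NonUnitalCStarAlgebra X]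
    [NonUnitalCStarAlgebra Y] (φ : X →⋆ₙₐ[ℂ] Y) (f : G → X) (w : StarPoly G) :
    StarPoly.eval (fun g => φ (f g)) w = φ (StarPoly.eval f w) := by
  have : StarPoly.eval (fun g => φ (f g)) =
      (φ : X →ₙₐ[ℂ] Y).comp (StarPoly.eval f) := by
    apply (MonoidAlgebra.liftMagma ℂ).symm.injective
    simp only [StarPoly.eval, Equiv.symm_apply_apply]
    refine FreeSemigroup.hom_ext ?_
    funext x
    rcases x with g | g
    · simp [MonoidAlgebra.liftMagma]
      rfl
    · simp [MonoidAlgebra.liftMagma, ← map_star]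
      rfl
  exact DFunLike.congr_fun this w

theorem StarPoly.adjoin_subset_range {G : Type u} {X : Type v} [NonUnitalCStarAlgebra X]
    (f : G → X) : (NonUnitalStarAlgebra.adjoin ℂ (Set.range f) : Set X) ⊆
      Set.range (StarPoly.eval f) := by
  have gen : ∀ x, StarPoly.eval f (MonoidAlgebra.ofMagma ℂ _ (FreeSemigroup.of x)) =
      Sum.elim f (fun g => star (f g)) x := by
    intro x
    simp [StarPoly.eval, MonoidAlgebra.liftMagma]
  intro x hx
  have hx' : x ∈ NonUnitalAlgebra.adjoin ℂ (Set.range f ∪ star (Set.range f)) := hx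
  have : NonUnitalAlgebra.adjoin ℂ (Set.range f ∪ star (Set.range f)) ≤
      NonUnitalAlgHom.range (StarPoly.eval f) := by
    refine NonUnitalAlgebra.adjoin_le ?_
    rintro y (⟨g, rfl⟩ | ⟨g, hg⟩)
    · exact ⟨_, gen (Sum.inl g)⟩
    · refine ⟨_, (gen (Sum.inr g)).trans ?_⟩
      simp [hg]
  exact this hx'

namespace CStarRelations

variable {G : Type u} (R : CStarRelations G)

/-- The representations in the class `R` up to equality of the induced seminorms on *-polynomials,
that is, up to isomorphism of the C*-algebras generated by their images. -/
def Index : Type u :=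
  {p : StarPoly G → ℝ // ∃ (X : Type u) (_ : NonUnitalCStarAlgebra X) (f : G → X),
    R.holds X f ∧ ∀ w, p w = ‖StarPoly.eval f w‖}

/-- The C*-algebra of a representation in the class `p`. -/
def Carrier (p : R.Index) : Type u := p.2.choose

instance (p : R.Index) : NonUnitalCStarAlgebra (R.Carrier p) := p.2.choose_spec.choose

/-- A representation in the class `p`. -/
def rep (p : R.Index) : G → R.Carrier p := p.2.choose_spec.choose_spec.choose

theorem holds_rep (p : R.Index) : R.holds (R.Carrier p) (R.rep p) :=
  p.2.choose_spec.choose_spec.choose_spec.1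

theorem norm_eval_rep (p : R.Index) (w : StarPoly G) :
    ‖StarPoly.eval (R.rep p) w‖ = p.1 w :=
  (p.2.choose_spec.choose_spec.choose_spec.2 w).symm

/-- The direct sum of all representations of the class `R`, with values in the `ℓ^∞`-product. -/
def sumRep (g : G) : lp R.Carrier ∞ :=
  ⟨fun p => R.rep p g, memℓp_infty ⟨R.bound g, by
    rintro _ ⟨p, rfl⟩
    exact R.norm_le _ _ (R.holds_rep p) g⟩⟩

/-- The universal C*-algebra of the class `R`: the C*-algebra generated by the image of the
direct sum of all representations of the class. -/
def Univ : Type u :=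
  ↥(NonUnitalStarAlgebra.adjoin ℂ (Set.range R.sumRep)).topologicalClosure

instance : NonUnitalCStarAlgebra R.Univ :=
  NonUnitalStarSubalgebra.nonUnitalCStarAlgebra
    (NonUnitalStarAlgebra.adjoin ℂ (Set.range R.sumRep)).topologicalClosure
    (h_closed := NonUnitalStarSubalgebra.isClosed_topologicalClosure _)

/-- The canonical image of a generator. -/
def of (g : G) : R.Univ :=
  ⟨R.sumRep g, NonUnitalStarSubalgebra.le_topologicalClosure _
    (NonUnitalStarAlgebra.subset_adjoin ℂ _ ⟨g, rfl⟩)⟩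

/-- The inclusion of the universal C*-algebra in the product. -/
def incl : R.Univ →⋆ₙₐ[ℂ] lp R.Carrier ∞ :=
  NonUnitalStarSubalgebraClass.subtype
    (NonUnitalStarAlgebra.adjoin ℂ (Set.range R.sumRep)).topologicalClosure

/-- The coordinate projections of the product. -/
def proj (p : R.Index) : lp R.Carrier ∞ →⋆ₙₐ[ℂ] R.Carrier p where
  toFun x := x p
  map_smul' _ _ := rfl
  map_zero' := rfl
  map_add' _ _ := rfl
  map_mul' _ _ := rfl
  map_star' _ := rfl

theorem dense_adjoin_of :
    Dense (NonUnitalStarAlgebra.adjoin ℂ (Set.range R.of) : Set R.Univ) := by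
  have hind : Topology.IsInducing R.incl := Topology.IsInducing.subtypeVal
  have himg : R.incl '' (NonUnitalStarAlgebra.adjoin ℂ (Set.range R.of) : Set R.Univ) =
      (NonUnitalStarAlgebra.adjoin ℂ (Set.range R.sumRep) : Set (lp R.Carrier ∞)) := by
    have := NonUnitalStarAlgHom.map_adjoin R.incl (Set.range R.of)
    rw [← Set.range_comp] at this
    exact congrArg SetLike.coe this
  intro x
  rw [hind.closure_eq_preimage_closure_image, himg]
  exact x.2

/-- The coordinates of the universal C*-algebra. -/
def coord (p : R.Index) : R.Univ →⋆ₙₐ[ℂ] R.Carrier p := (R.proj p).comp R.incl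

theorem coord_of (p : R.Index) (g : G) : R.coord p (R.of g) = R.rep p g := rfl

theorem ext_coord {x y : R.Univ} (h : ∀ p, R.coord p x = R.coord p y) : x = y :=
  Subtype.ext (lp.ext (funext h))

theorem hom_ext {X : Type v} [NonUnitalCStarAlgebra X] {φ ψ : R.Univ →⋆ₙₐ[ℂ] X}
    (h : ∀ g, φ (R.of g) = ψ (R.of g)) : φ = ψ := by
  have hφ : Continuous φ := AddMonoidHomClass.continuous_of_bound φ 1 (fun x => by
    simpa only [one_mul] using NonUnitalStarAlgHom.norm_apply_le φ x)
  have hψ : Continuous ψ := AddMonoidHomClass.continuous_of_bound ψ 1 (fun x => by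
    simpa only [one_mul] using NonUnitalStarAlgHom.norm_apply_le ψ x)
  refine DFunLike.coe_injective (hφ.ext_on R.dense_adjoin_of hψ ?_)
  intro x hx
  have : NonUnitalStarAlgebra.adjoin ℂ (Set.range R.of) ≤ NonUnitalStarAlgHom.equalizer φ ψ := by
    refine NonUnitalStarAlgebra.adjoin_le ?_
    rintro _ ⟨g, rfl⟩
    exact h g
  exact this hx

theorem norm_eval_le {X : Type u} [NonUnitalCStarAlgebra X] {f : G → X} (hf : R.holds X f)
    (w : StarPoly G) : ‖StarPoly.eval f w‖ ≤ ‖StarPoly.eval R.of w‖ := by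
  let p : R.Index := ⟨fun w => ‖StarPoly.eval f w‖, X, _, f, hf, fun _ => rfl⟩
  have h1 : StarPoly.eval (R.rep p) w = ((R.proj p).comp R.incl) (StarPoly.eval R.of w) :=
    StarPoly.eval_comp ((R.proj p).comp R.incl) R.of w
  calc ‖StarPoly.eval f w‖ = ‖StarPoly.eval (R.rep p) w‖ := (R.norm_eval_rep p w).symm
    _ ≤ ‖StarPoly.eval R.of w‖ := by
      rw [h1]
      exact NonUnitalStarAlgHom.norm_apply_le _ _

/-- The universal property of the universal C*-algebra. -/
theorem existsUnique_lift {X : Type u} [NonUnitalCStarAlgebra X] {f : G → X} (hf : R.holds X f) :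
    ∃! φ : R.Univ →⋆ₙₐ[ℂ] X, ∀ g, φ (R.of g) = f g := by
  -- the C*-algebra generated by the pairs `(R.of g, f g)` is the graph of the lift
  let e : G → R.Univ × X := fun g => (R.of g, f g)
  let E := (NonUnitalStarAlgebra.adjoin ℂ (Set.range e)).topologicalClosure
  have hE : IsClosed (E : Set (R.Univ × X)) :=
    NonUnitalStarSubalgebra.isClosed_topologicalClosure _
  let _ : NonUnitalCStarAlgebra E := NonUnitalStarSubalgebra.nonUnitalCStarAlgebra E
  have hle : ∀ z ∈ E, ‖z.2‖ ≤ ‖z.1‖ := by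
    have hc : IsClosed {z : R.Univ × X | ‖z.2‖ ≤ ‖z.1‖} :=
      isClosed_le continuous_snd.norm continuous_fst.norm
    change (E : Set (R.Univ × X)) ⊆ _
    refine closure_minimal ?_ hc
    intro y hy
    obtain ⟨w, rfl⟩ := StarPoly.adjoin_subset_range e hy
    have h1 := StarPoly.eval_comp (NonUnitalStarAlgHom.fst ℂ R.Univ X) e w
    have h2 := StarPoly.eval_comp (NonUnitalStarAlgHom.snd ℂ R.Univ X) e w
    have := R.norm_eval_le hf w
    change ‖NonUnitalStarAlgHom.snd ℂ R.Univ X _‖ ≤ ‖NonUnitalStarAlgHom.fst ℂ R.Univ X _‖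
    rw [← h1, ← h2]
    exact this
  let π₁ : E →⋆ₙₐ[ℂ] R.Univ :=
    (NonUnitalStarAlgHom.fst ℂ R.Univ X).comp (NonUnitalStarSubalgebraClass.subtype E)
  let π₂ : E →⋆ₙₐ[ℂ] X :=
    (NonUnitalStarAlgHom.snd ℂ R.Univ X).comp (NonUnitalStarSubalgebraClass.subtype E)
  have hinj : Function.Injective π₁ := by
    rw [injective_iff_map_eq_zero]
    rintro ⟨z, hz⟩ h0
    have h0' : z.1 = 0 := h0
    have := hle z hz
    rw [h0', norm_zero] at this
    exact Subtype.ext (Prod.ext h0' (norm_le_zero_iff.1 this))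
  have hmem : ∀ g, e g ∈ E := fun g => NonUnitalStarSubalgebra.le_topologicalClosure _
    (NonUnitalStarAlgebra.subset_adjoin ℂ _ ⟨g, rfl⟩)
  have hsurj : Function.Surjective π₁ := by
    have hcl : IsClosed (Set.range π₁) :=
      (NonUnitalStarAlgHom.isometry π₁ hinj).isClosedEmbedding.isClosed_range
    intro x
    have hsub : (NonUnitalStarAlgebra.adjoin ℂ (Set.range R.of) : Set R.Univ) ⊆ Set.range π₁ := by
      have : NonUnitalStarAlgebra.adjoin ℂ (Set.range R.of) ≤ NonUnitalStarAlgHom.range π₁ := by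
        refine NonUnitalStarAlgebra.adjoin_le ?_
        rintro _ ⟨g, rfl⟩
        exact ⟨⟨e g, hmem g⟩, rfl⟩
      intro y hy
      exact this hy
    exact closure_minimal hsub hcl (R.dense_adjoin_of x)
  let Θ : E ≃⋆ₐ[ℂ] R.Univ := StarAlgEquiv.ofBijective π₁ ⟨hinj, hsurj⟩
  have hφ : ∀ g, π₂.comp Θ.symm.toNonUnitalStarAlgHom (R.of g) = f g := by
    intro g
    have : Θ.symm (R.of g) = ⟨e g, hmem g⟩ := (Equiv.symm_apply_eq Θ.toEquiv).2 rfl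
    exact congrArg π₂ this
  exact ⟨_, hφ, fun ψ hψ => R.hom_ext fun g => (hψ g).trans (hφ g).symm⟩

end CStarRelations

/-! ### Maximal C*-covers -/

/-- The C*-norm of a `k × k` matrix over a C*-algebra. (The norm of `CStarMatrix` is stated with
respect to the order of the C*-algebra, which is determined by its *-algebra structure.) -/
def matNorm {X : Type u} [NonUnitalCStarAlgebra X] {k : ℕ} (m : Matrix (Fin k) (Fin k) X) : ℝ :=
  letI := CStarAlgebra.spectralOrder X
  haveI := CStarAlgebra.spectralOrderedRing X
  ‖CStarMatrix.ofMatrix m‖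

/-- A completely contractive representation of the operator algebra `A ⊆ M` in a C*-algebra:
a linear and multiplicative map all of whose matrix amplifications are contractive. -/
structure IsCCRep {M : Type u} [CStarAlgebra M] (A : Subalgebra ℂ M) {X : Type v}
    [NonUnitalCStarAlgebra X] (f : A → X) : Prop where
  map_add : ∀ a b, f (a + b) = f a + f b
  map_smul : ∀ (c : ℂ) a, f (c • a) = c • f a
  map_mul : ∀ a b, f (a * b) = f a * f b
  matNorm_le : ∀ (k : ℕ) (m : Matrix (Fin k) (Fin k) A),
    matNorm (m.map f) ≤ matNorm (m.map fun a => (a : M))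

section MatNorm

variable {X : Type u} [NonUnitalCStarAlgebra X]

theorem norm_le_matNorm (x : X) : ‖x‖ ≤ matNorm (k := 1) (fun _ _ => x) := by
  let _ := CStarAlgebra.spectralOrder X
  have _ := CStarAlgebra.spectralOrderedRing X
  exact CStarMatrix.norm_entry_le_norm (M := CStarMatrix.ofMatrix fun _ _ : Fin 1 => x)
    (i := 0) (j := 0)

theorem matNorm_le_norm (x : X) : matNorm (k := 1) (fun _ _ => x) ≤ ‖x‖ := by
  let _ := CStarAlgebra.spectralOrder X
  have _ := CStarAlgebra.spectralOrderedRing X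
  exact NonUnitalStarAlgHom.norm_apply_le
    
    { toFun := fun x => CStarMatrix.ofMatrix fun _ _ => x
      map_smul' := fun _ _ => rfl
      map_zero' := rfl
      map_add' := fun _ _ => rfl
      map_mul' := fun a b => by
        ext i j
        simp [CStarMatrix.mul_apply]
        rfl
      map_star' := fun _ => rfl : X →⋆ₙₐ[ℂ] CStarMatrix (Fin 1) (Fin 1) X } x

theorem IsCCRep.norm_le {M : Type u} [CStarAlgebra M] {A : Subalgebra ℂ M} {X : Type v}
    [NonUnitalCStarAlgebra X] {f : A → X} (hf : IsCCRep A f) (a : A) : ‖f a‖ ≤ ‖a‖ :=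
  (norm_le_matNorm (f a)).trans
    ((hf.matNorm_le 1 fun _ _ => a).trans (matNorm_le_norm (a : M)))

end MatNorm

theorem matNorm_map_le {X : Type u} {Y : Type v} [NonUnitalCStarAlgebra X]
    [NonUnitalCStarAlgebra Y] (φ : X →⋆ₙₐ[ℂ] Y) {k : ℕ} (m : Matrix (Fin k) (Fin k) X) :
    matNorm (m.map φ) ≤ matNorm m := by
  let _ := CStarAlgebra.spectralOrder X
  have _ := CStarAlgebra.spectralOrderedRing X
  let _ := CStarAlgebra.spectralOrder Y
  have _ := CStarAlgebra.spectralOrderedRing Y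
  exact NonUnitalStarAlgHom.norm_apply_le (CStarMatrix.mapₙₐ (n := Fin k) φ)
    (CStarMatrix.ofMatrix m)

theorem CStarRelations.matNorm_le {G : Type u} (R : CStarRelations G) {k : ℕ}
    (m : Matrix (Fin k) (Fin k) R.Univ) {r : ℝ} (hr : 0 ≤ r)
    (h : ∀ p, matNorm (m.map (R.coord p)) ≤ r) : matNorm m ≤ r := by
  let _ := CStarAlgebra.spectralOrder R.Univ
  have _ := CStarAlgebra.spectralOrderedRing R.Univ
  let _ : ∀ p, PartialOrder (R.Carrier p) := fun p => CStarAlgebra.spectralOrder _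
  have _ : ∀ p, StarOrderedRing (R.Carrier p) := fun p => CStarAlgebra.spectralOrderedRing _
  let Ψ : CStarMatrix (Fin k) (Fin k) R.Univ →⋆ₙₐ[ℂ]
      lp (fun p => CStarMatrix (Fin k) (Fin k) (R.Carrier p)) ∞ :=
    { toFun := fun x => ⟨fun p => CStarMatrix.mapₙₐ (R.coord p) x, memℓp_infty ⟨‖x‖, by
        rintro _ ⟨p, rfl⟩
        exact NonUnitalStarAlgHom.norm_apply_le _ _⟩⟩
      map_smul' := fun c x => lp.ext (funext fun p => map_smul (CStarMatrix.mapₙₐ (R.coord p)) c x)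
      map_zero' := lp.ext (funext fun p => map_zero (CStarMatrix.mapₙₐ (R.coord p)))
      map_add' := fun x y =>
        lp.ext (funext fun p => map_add (CStarMatrix.mapₙₐ (R.coord p)) x y)
      map_mul' := fun x y =>
        lp.ext (funext fun p => map_mul (CStarMatrix.mapₙₐ (R.coord p)) x y)
      map_star' := fun x => lp.ext (funext fun p => map_star (CStarMatrix.mapₙₐ (R.coord p)) x) }
  have hΨ : Function.Injective Ψ := by
    intro x y hxy
    ext i j
    refine R.ext_coord fun p => ?_
    have h1 : Ψ x p = Ψ y p := by rw [hxy]
    exact congrFun (congrFun h1 i) j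
  calc matNorm m = ‖Ψ (CStarMatrix.ofMatrix m)‖ :=
        (NonUnitalStarAlgHom.norm_map Ψ hΨ _).symm
    _ ≤ r := lp.norm_le_of_forall_le hr h

/-- The completely contractive representations of `A`. -/
def ccRelations {M : Type u} [CStarAlgebra M] (A : Subalgebra ℂ M) : CStarRelations A where
  holds _ _ f := IsCCRep A f
  bound a := ‖a‖
  norm_le _ _ _ hf := hf.norm_le

/-- The maximal C*-cover `C*_max(A)` of the operator algebra `A`: the universal C*-algebra for the
completely contractive representations of `A` in C*-algebras. -/
def MaxCover {M : Type u} [CStarAlgebra M] (A : Subalgebra ℂ M) : Type u := (ccRelations A).Univ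

instance {M : Type u} [CStarAlgebra M] (A : Subalgebra ℂ M) : NonUnitalCStarAlgebra (MaxCover A) :=
  inferInstanceAs (NonUnitalCStarAlgebra (ccRelations A).Univ)

/-- The canonical embedding `A → C*_max(A)`. -/
def MaxCover.of {M : Type u} [CStarAlgebra M] (A : Subalgebra ℂ M) (a : A) : MaxCover A :=
  (ccRelations A).of a

theorem matNorm_nonneg {X : Type u} [NonUnitalCStarAlgebra X] {k : ℕ}
    (m : Matrix (Fin k) (Fin k) X) : 0 ≤ matNorm m := by
  let _ := CStarAlgebra.spectralOrder X
  have _ := CStarAlgebra.spectralOrderedRing X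
  exact norm_nonneg (CStarMatrix.ofMatrix m)

namespace MaxCover

variable {M : Type u} [CStarAlgebra M] (A : Subalgebra ℂ M)

theorem isCCRep_of : IsCCRep A (of A) where
  map_add a b := (ccRelations A).ext_coord fun p => ((ccRelations A).holds_rep p).map_add a b
  map_smul c a := (ccRelations A).ext_coord fun p => ((ccRelations A).holds_rep p).map_smul c a
  map_mul a b := (ccRelations A).ext_coord fun p => ((ccRelations A).holds_rep p).map_mul a b
  matNorm_le k m := (ccRelations A).matNorm_le _ (matNorm_nonneg _)
    fun p => ((ccRelations A).holds_rep p).matNorm_le k m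

theorem of_zero : of A 0 = 0 := by
  simpa using (isCCRep_of A).map_smul 0 0

/-- Every completely contractive representation of `A` in a C*-algebra extends uniquely to a
*-homomorphism of `C*_max(A)`. -/
theorem existsUnique_lift {X : Type u} [NonUnitalCStarAlgebra X] {f : A → X} (hf : IsCCRep A f) :
    ∃! φ : MaxCover A →⋆ₙₐ[ℂ] X, ∀ a, φ (of A a) = f a :=
  (ccRelations A).existsUnique_lift hf

/-- The canonical embedding is completely isometric. -/
theorem matNorm_map_of {k : ℕ} (m : Matrix (Fin k) (Fin k) A) :
    matNorm (m.map (of A)) = matNorm (m.map fun a => (a : M)) := by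
  refine le_antisymm ((isCCRep_of A).matNorm_le k m) ?_
  have hid : IsCCRep A (fun a : A => (a : M)) :=
    ⟨fun _ _ => rfl, fun _ _ => rfl, fun _ _ => rfl, fun _ _ => le_rfl⟩
  obtain ⟨φ, hφ, -⟩ := existsUnique_lift A hid
  have h := matNorm_map_le φ (m.map (of A))
  have h2 : (m.map (of A)).map φ = m.map fun a => (a : M) := by
    ext i j
    exact hφ _
  rwa [h2] at h

/-- `A` generates its maximal C*-cover. -/
theorem dense_adjoin_of :
    Dense (NonUnitalStarAlgebra.adjoin ℂ (Set.range (of A)) : Set (MaxCover A)) :=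
  (ccRelations A).dense_adjoin_of

end MaxCover

/-! ### Amalgamated free products -/

/-- Families of *-homomorphisms of the `C i` into a C*-algebra which agree on `D`. -/
def amalgRelations {ι : Type u} (C : ι → Type u) [∀ i, NonUnitalCStarAlgebra (C i)]
    {D : Type u} [NonUnitalCStarAlgebra D] (δ : ∀ i, D →⋆ₙₐ[ℂ] C i) :
    CStarRelations (Σ i, C i) where
  holds X _ f := ∃ φ : ∀ i, C i →⋆ₙₐ[ℂ] X,
    (∀ i c, f ⟨i, c⟩ = φ i c) ∧ ∀ i j d, φ i (δ i d) = φ j (δ j d)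
  bound g := ‖g.2‖
  norm_le := by
    rintro X _ f ⟨φ, hφ, -⟩ ⟨i, c⟩
    rw [hφ]
    exact NonUnitalStarAlgHom.norm_apply_le (φ i) c

/-- The free product of the C*-algebras `C i` amalgamated over `D`, along `δ i : D → C i`. -/
def AmalgFreeProd {ι : Type u} (C : ι → Type u) [∀ i, NonUnitalCStarAlgebra (C i)]
    {D : Type u} [NonUnitalCStarAlgebra D] (δ : ∀ i, D →⋆ₙₐ[ℂ] C i) : Type u :=
  (amalgRelations C δ).Univ

instance {ι : Type u} (C : ι → Type u) [∀ i, NonUnitalCStarAlgebra (C i)]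
    {D : Type u} [NonUnitalCStarAlgebra D] (δ : ∀ i, D →⋆ₙₐ[ℂ] C i) :
    NonUnitalCStarAlgebra (AmalgFreeProd C δ) :=
  inferInstanceAs (NonUnitalCStarAlgebra (amalgRelations C δ).Univ)

/-- The canonical *-homomorphism of `C i` into the amalgamated free product. -/
def AmalgFreeProd.of {ι : Type u} {C : ι → Type u} [∀ i, NonUnitalCStarAlgebra (C i)]
    {D : Type u} [NonUnitalCStarAlgebra D] (δ : ∀ i, D →⋆ₙₐ[ℂ] C i) (i : ι) :
    C i →⋆ₙₐ[ℂ] AmalgFreeProd C δ where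
  toFun c := (amalgRelations C δ).of ⟨i, c⟩
  map_smul' t c := (amalgRelations C δ).ext_coord fun p => by
    obtain ⟨φ, hφ, -⟩ := (amalgRelations C δ).holds_rep p
    refine Eq.trans ?_ (map_smul ((amalgRelations C δ).coord p) t _).symm
    simp [CStarRelations.coord_of, hφ]
  map_zero' := (amalgRelations C δ).ext_coord fun p => by
    obtain ⟨φ, hφ, -⟩ := (amalgRelations C δ).holds_rep p
    refine Eq.trans ?_ (map_zero ((amalgRelations C δ).coord p)).symm
    simp [CStarRelations.coord_of, hφ]
  map_add' a b := (amalgRelations C δ).ext_coord fun p => by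
    obtain ⟨φ, hφ, -⟩ := (amalgRelations C δ).holds_rep p
    refine Eq.trans ?_ (map_add ((amalgRelations C δ).coord p) _ _).symm
    simp [CStarRelations.coord_of, hφ]
  map_mul' a b := (amalgRelations C δ).ext_coord fun p => by
    obtain ⟨φ, hφ, -⟩ := (amalgRelations C δ).holds_rep p
    refine Eq.trans ?_ (map_mul ((amalgRelations C δ).coord p) _ _).symm
    simp [CStarRelations.coord_of, hφ]
  map_star' a := (amalgRelations C δ).ext_coord fun p => by
    obtain ⟨φ, hφ, -⟩ := (amalgRelations C δ).holds_rep p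
    refine Eq.trans ?_ (map_star ((amalgRelations C δ).coord p) _).symm
    simp [CStarRelations.coord_of, hφ, map_star]

namespace AmalgFreeProd

variable {ι : Type u} {C : ι → Type u} [∀ i, NonUnitalCStarAlgebra (C i)]
  {D : Type u} [NonUnitalCStarAlgebra D] (δ : ∀ i, D →⋆ₙₐ[ℂ] C i)

theorem of_amalg (i j : ι) (d : D) : of δ i (δ i d) = of δ j (δ j d) :=
  (amalgRelations C δ).ext_coord fun p => by
    obtain ⟨φ, hφ, hD⟩ := (amalgRelations C δ).holds_rep p
    change (amalgRelations C δ).rep p ⟨i, δ i d⟩ = (amalgRelations C δ).rep p ⟨j, δ j d⟩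
    rw [hφ, hφ, hD]

/-- The universal property of the amalgamated free product. -/
theorem existsUnique_lift {X : Type u} [NonUnitalCStarAlgebra X] (φ : ∀ i, C i →⋆ₙₐ[ℂ] X)
    (hφ : ∀ i j d, φ i (δ i d) = φ j (δ j d)) :
    ∃! Φ : AmalgFreeProd C δ →⋆ₙₐ[ℂ] X, ∀ i c, Φ (of δ i c) = φ i c := by
  obtain ⟨Φ, h1, h2⟩ := (amalgRelations C δ).existsUnique_lift (f := fun g => φ g.1 g.2)
    ⟨φ, fun _ _ => rfl, hφ⟩
  exact ⟨Φ, fun i c => h1 ⟨i, c⟩, fun Ψ hΨ => h2 Ψ fun g => hΨ g.1 g.2⟩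

end AmalgFreeProd

/-! ### Graph operator algebras -/

section Graph

open scoped Quiver

/-- The isometry `ℓ²(K) → ℓ²(S)`, `ξ_k ↦ ξ_{f k}`, given by an injection `f : K → S`. -/
def ell2Map {K S : Type u} (f : K → S) (hf : Function.Injective f) :
    lp (fun _ : K => ℂ) 2 →ₗᵢ[ℂ] lp (fun _ : S => ℂ) 2 :=
  (((HilbertBasis.ofRepr (.refl ℂ (lp (fun _ : S => ℂ) 2))).orthonormal.comp f
    hf).orthogonalFamily).linearIsometry

/-- The partial isometry of `ℓ²(S)` which maps `ξ_{g k}` to `ξ_{f k}` for each `k` and vanishes on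
the orthogonal complement of the `ξ_{g k}`. -/
def ell2Shift {K S : Type u} (f g : K → S) (hf : Function.Injective f)
    (hg : Function.Injective g) :
    lp (fun _ : S => ℂ) 2 →L[ℂ] lp (fun _ : S => ℂ) 2 :=
  (ell2Map f hf).toContinuousLinearMap ∘L
    ContinuousLinearMap.adjoint (ell2Map g hg).toContinuousLinearMap

variable (V : Type u) [Quiver.{u} V]

/-- The finite paths of a directed graph, including the paths of length zero (the vertices). -/
abbrev PathSpace : Type u := Σ a b : V, Quiver.Path a b

/-- The Fock space `ℓ²(PathSpace V)` of a directed graph. -/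
abbrev FockSpace : Type u := lp (fun _ : PathSpace V => ℂ) 2

variable {V}

/-- The paths that start at `a`. -/
def pathsFrom (a : V) (w : Σ c : V, Quiver.Path a c) : PathSpace V := ⟨a, w⟩

/-- The path `ew`: first the edge `e`, then the path `w`. -/
def prependEdge {a b : V} (e : a ⟶ b) (w : Σ c : V, Quiver.Path b c) : PathSpace V :=
  ⟨a, w.1, e.toPath.comp w.2⟩

theorem pathsFrom_injective (a : V) : Function.Injective (pathsFrom a) :=
  fun _ _ h => sigma_mk_injective (β := fun a : V => Σ c : V, Quiver.Path a c) h

theorem prependEdge_injective {a b : V} (e : a ⟶ b) : Function.Injective (prependEdge e) := by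
  rintro ⟨c, w⟩ ⟨c', w'⟩ h
  have h1 := sigma_mk_injective h
  obtain rfl : c = c' := congrArg Sigma.fst h1
  have h2 := sigma_mk_injective h1
  rw [show w = w' from Quiver.Path.comp_injective_right _ h2]

/-- The projection `P_a` onto the span of the `ξ_w` with `w` starting at `a`. -/
def vertexProj (a : V) : FockSpace V →L[ℂ] FockSpace V :=
  ell2Shift (pathsFrom a) (pathsFrom a) (pathsFrom_injective a) (pathsFrom_injective a)

/-- The creation operator `L_e`, for an edge `e` from `a` to `b`: it maps `ξ_w` to `ξ_{ew}` if `w`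
starts at `b`, and to `0` otherwise. Thus `L_e = P_a L_e P_b`, as for the matrix unit `E_{ab}`. -/
def creation {a b : V} (e : a ⟶ b) : FockSpace V →L[ℂ] FockSpace V :=
  ell2Shift (prependEdge e) (pathsFrom b) (prependEdge_injective e) (pathsFrom_injective b)

variable (V) in
/-- The operator algebra `A(G)` of a directed graph `G` with finitely many vertices: the norm-closed
algebra generated by the vertex projections and the creation operators of the edges. (It contains
the identity, which is the sum of the vertex projections.) -/
def graphAlg [Finite V] : Subalgebra ℂ (FockSpace V →L[ℂ] FockSpace V) :=
  (Algebra.adjoin ℂ (Set.range vertexProj ∪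
    {T | ∃ (a b : V) (e : a ⟶ b), T = creation e})).topologicalClosure

theorem vertexProj_mem [Finite V] (a : V) : vertexProj a ∈ graphAlg V :=
  Subalgebra.le_topologicalClosure _ (Algebra.subset_adjoin (Or.inl ⟨a, rfl⟩))

theorem creation_mem [Finite V] {a b : V} (e : a ⟶ b) : creation e ∈ graphAlg V :=
  Subalgebra.le_topologicalClosure _ (Algebra.subset_adjoin (Or.inr ⟨a, b, e, rfl⟩))

end Graph

/-! ### The algebras of the theorem -/

/-- The algebra `T_n` of upper triangular matrices. -/
def upperTri (n : ℕ) : Subalgebra ℂ (Matrix (Fin n) (Fin n) ℂ) where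
  carrier := {m | ∀ r c, c < r → m r c = 0}
  mul_mem' {a b} ha hb r c h := by
    refine (Matrix.mul_apply).trans (Finset.sum_eq_zero fun s _ => ?_)
    rcases lt_or_ge s r with hs | hs
    · simp [ha r s hs]
    · simp [hb s c (h.trans_le hs)]
  add_mem' {a b} ha hb r c h := by simp [ha r c h, hb r c h]
  algebraMap_mem' t r c h := by simp [Matrix.algebraMap_matrix_apply, h.ne']

/-- The matrices whose only possibly nonzero entries are the diagonal ones and the entry `(i, k)`,
that is, `D_n + ℂ E_{ik}`. -/
def cornerAlg {n : ℕ} (i k : Fin n) : Subalgebra ℂ (Matrix (Fin n) (Fin n) ℂ) where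
  carrier := {m | ∀ r c, r ≠ c → (r, c) ≠ (i, k) → m r c = 0}
  mul_mem' {a b} ha hb r c h h' := by
    refine (Matrix.mul_apply).trans (Finset.sum_eq_zero fun s _ => ?_)
    by_contra hne
    have h1 : r = s ∨ (r, s) = (i, k) := by
      by_contra! h1
      exact hne (by simp [ha r s h1.1 h1.2])
    have h2 : s = c ∨ (s, c) = (i, k) := by
      by_contra! h2
      exact hne (by simp [hb s c h2.1 h2.2])
    grind
  add_mem' {a b} ha hb r c h h' := by simp [ha r c h h', hb r c h h']
  algebraMap_mem' t r c h _ := by simp [Matrix.algebraMap_matrix_apply, h]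

theorem single_mem_cornerAlg {n : ℕ} (i k : Fin n) (t : ℂ) :
    Matrix.single i k t ∈ cornerAlg i k := by
  intro r c _ h
  refine Matrix.single_apply_of_ne _ _ _ _ _ ?_
  grind

theorem diagonal_mem_cornerAlg {n : ℕ} (i k : Fin n) (d : Fin n → ℂ) :
    Matrix.diagonal d ∈ cornerAlg i k :=
  fun _ _ h _ => Matrix.diagonal_apply_ne d h

theorem cornerAlg_le_upperTri {n : ℕ} {i k : Fin n} (h : i ≤ k) : cornerAlg i k ≤ upperTri n := by
  intro m hm r c hrc
  refine hm r c hrc.ne' ?_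
  grind

/-- For `0 ≤ i < n - 1`, the algebra `T_2` of upper triangular `2 × 2` matrices placed in the rows
and columns `i` and `i + 1`, in direct sum with `ℂ` at each of the other diagonal positions. -/
abbrev stepAlg (n : ℕ) (i : Fin (n - 1)) : Subalgebra ℂ (Matrix (Fin n) (Fin n) ℂ) :=
  cornerAlg ⟨i, by omega⟩ ⟨i + 1, by omega⟩

/-- The successor of `i` modulo `n`. -/
def cyc {n : ℕ} (i : Fin n) : Fin n := ⟨(i + 1) % n, Nat.mod_lt _ i.pos⟩

/-- For `i < n - 1` this is again `T_2` in the rows and columns `i` and `i + 1`; for `i = n - 1` it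
consists of the matrices whose only possibly nonzero entry off the diagonal is in the last row and
the first column. -/
abbrev cycleStepAlg (n : ℕ) (i : Fin n) : Subalgebra ℂ (Matrix (Fin n) (Fin n) ℂ) :=
  cornerAlg i (cyc i)

theorem stepAlg_le_upperTri (n : ℕ) (i : Fin (n - 1)) : stepAlg n i ≤ upperTri n :=
  cornerAlg_le_upperTri (Nat.le_succ i)

/-- A contractive idempotent of a C*-algebra is selfadjoint. -/
theorem star_eq_self_of_contractive_idempotent {X : Type u} [NonUnitalCStarAlgebra X] {p : X}
    (hp : p * p = p) (h1 : ‖p‖ ≤ 1) : star p = p := by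
  let _ := CStarAlgebra.spectralOrder X
  have _ := CStarAlgebra.spectralOrderedRing X
  have hsp : star p * star p = star p := by rw [← star_mul, hp]
  have e1 : star (p - star p * p) * (p - star p * p) =
      star p * (p * star p) * p - star p * p := by
    simp only [star_sub, star_mul, star_star, sub_mul, mul_sub]
    have a1 : star p * (star p * p) = star p * p := by rw [← mul_assoc, hsp]
    have a2 : star p * p * p = star p * p := by rw [mul_assoc, hp]
    have a3 : star p * p * (star p * p) = star p * (p * star p) * p := by simp only [mul_assoc]
    rw [a1, a2, a3]
    abel
  have e2 : star p * (p * star p) * p ≤ ‖p * star p‖ • (star p * p) :=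
    CStarAlgebra.star_left_conjugate_le_norm_smul (IsSelfAdjoint.mul_star_self p)
  have hn : ‖p * star p‖ ≤ 1 := by
    rw [CStarRing.norm_self_mul_star]
    nlinarith [norm_nonneg p]
  have e3 : ‖p * star p‖ • (star p * p) ≤ star p * p := by
    simpa using smul_le_smul_of_nonneg_right hn (star_mul_self_nonneg p)
  have e4 : star (p - star p * p) * (p - star p * p) ≤ 0 := by
    rw [e1]
    exact sub_nonpos.2 (e2.trans e3)
  have e5 : p - star p * p = 0 :=
    CStarRing.star_mul_self_eq_zero_iff _ |>.1 (le_antisymm e4 (star_mul_self_nonneg _))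
  have e6 : p = star p * p := sub_eq_zero.1 e5
  calc star p = star (star p * p) := by rw [← e6]
    _ = star p * p := by rw [star_mul, star_star]
    _ = p := e6.symm

/-- The embedding of the algebra `D_n ≅ ℂ^n` of diagonal matrices in `C*_max(A)`, for an algebra `A`
of matrices that contains `D_n`. -/
def diagEmb {n : ℕ} (A : Subalgebra ℂ (Matrix (Fin n) (Fin n) ℂ))
    (hA : ∀ d : Fin n → ℂ, Matrix.diagonal d ∈ A) : (Fin n → ℂ) →⋆ₙₐ[ℂ] MaxCover A where
  toFun d := MaxCover.of A ⟨Matrix.diagonal d, hA d⟩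
  map_smul' t d := by
    refine Eq.trans ?_ ((MaxCover.isCCRep_of A).map_smul t _)
    exact congrArg _ (Subtype.ext (Matrix.diagonal_smul t d))
  map_zero' := by
    refine Eq.trans (congrArg _ (Subtype.ext ?_)) (MaxCover.of_zero A)
    exact Matrix.diagonal_zero
  map_add' d d' := by
    refine Eq.trans ?_ ((MaxCover.isCCRep_of A).map_add _ _)
    exact congrArg _ (Subtype.ext (Matrix.diagonal_add d d').symm)
  map_mul' d d' := by
    refine Eq.trans ?_ ((MaxCover.isCCRep_of A).map_mul _ _)
    exact congrArg _ (Subtype.ext (Matrix.diagonal_mul_diagonal d d').symm)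
  map_star' d := by
    let q : Fin n → MaxCover A := fun k => MaxCover.of A ⟨Matrix.diagonal (Pi.single k 1), hA _⟩
    have hlin : ∀ x : Fin n → ℂ, MaxCover.of A ⟨Matrix.diagonal x, hA x⟩ = ∑ k, x k • q k := by
      intro x
      let L : (Fin n → ℂ) →ₗ[ℂ] MaxCover A :=
        { toFun := fun d => MaxCover.of A ⟨Matrix.diagonal d, hA d⟩
          map_add' := fun d d' => by
            refine Eq.trans ?_ ((MaxCover.isCCRep_of A).map_add _ _)
            exact congrArg _ (Subtype.ext (Matrix.diagonal_add d d').symm)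
          map_smul' := fun t d => by
            refine Eq.trans ?_ ((MaxCover.isCCRep_of A).map_smul t _)
            exact congrArg _ (Subtype.ext (Matrix.diagonal_smul t d)) }
      refine (L.pi_apply_eq_sum_univ x).trans (Finset.sum_congr rfl fun k _ => ?_)
      refine congrArg (fun y => x k • L y) (funext fun i => ?_)
      simp [Pi.single_apply, eq_comm]
    have hq : ∀ k, star (q k) = q k := by
      intro k
      refine star_eq_self_of_contractive_idempotent ?_ ?_
      · refine ((MaxCover.isCCRep_of A).map_mul _ _).symm.trans ?_
        refine congrArg _ (Subtype.ext ((Matrix.diagonal_mul_diagonal _ _).trans ?_))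
        congr 1
        funext i
        by_cases h : i = k <;> simp [h]
      · refine ((MaxCover.isCCRep_of A).norm_le _).trans ?_
        refine (Matrix.l2_opNorm_diagonal _).trans_le ?_
        refine (pi_norm_le_iff_of_nonneg zero_le_one).2 fun i => ?_
        by_cases h : i = k <;> simp [h]
    rw [hlin, hlin d, star_sum]
    refine Finset.sum_congr rfl fun k _ => ?_
    rw [star_smul, hq]
    rfl

/-- The vertices of the `n`-cycle. -/
def CycleGraph (n : ℕ) : Type := Fin n

instance (n : ℕ) : Finite (CycleGraph n) := inferInstanceAs (Finite (Fin n))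

/-- The edges of the `n`-cycle: one edge from `i` to its successor modulo `n`. -/
instance (n : ℕ) : Quiver.{0} (CycleGraph n) where
  Hom i k := PLift (k = cyc (n := n) i)

/-- The edge of the `n`-cycle that starts at `i`. -/
def cycleEdge {n : ℕ} (i : Fin n) :
    Quiver.Hom (V := CycleGraph n) i (cyc i) := ⟨rfl⟩

end

/-! Both sides are universal for the same data. A completely contractive representation of `A` (one
of `upperTri n` and `graphAlg (CycleGraph n)`) sends the vertex idempotents to mutually orthogonal
projections `q k`, because a contractive idempotent is selfadjoint, and the edge generators to
contractions `x i = q (s i) * x i * q (t i)`; by `HasGenerators.ext` it is determined by these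
values. A *-homomorphism of the free product amounts to the same data: the factor `cornerAlg (s i)
(t i)` contributes the contraction `x i`, and amalgamation over the diagonal identifies the
projections. So `exists_starAlgEquiv` reduces the theorem to the converse: all such families arise
from completely contractive representations. This is `exists_isCCRep_cornerAlg` for the factors, and
`exists_isCCRep_upperTri` and `exists_isCCRep_cycle` for the two algebras `A`.

The converse is a Poisson kernel construction, carried out inside the target C*-algebra without any
dilation. Choose `d b` selfadjoint with square `q b - x b * star (x b)`, and attach to a path `w`
the product `W w` of the `x` along `w`, followed by `d` at its end (`chainProd`). The sum of `W w *
star (W w)` over the paths from `b` telescopes to `q b` minus a remainder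
(`sum_chainProd_mul_star`). So `W` is a contractive row, and `a ↦ ∑ a_{w,w'} W w * star (W w')` is
completely contractive (`MatLE.sum_smul_mul_star`). Since `W (e w) = x e * W w`, left multiplication
by the generator of `e` becomes left multiplication by `x e`, and this forces multiplicativity on
the algebra of the generators.

For triangular matrices the paths stop at the last vertex, the remainder is zero and all sums are
finite (`exists_isCCRep_of_rows`). On the cycle the remainder may persist, so `x` is replaced by `r
• x` with `r < 1` and the paths are cut off at length `N`. Letting `r → 1` and `N → ∞` with `r ^ N *
(N + 1) → 0`, the left module property holds in the limit, which suffices by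
`exists_isCCRep_of_tendsto`. -/

/-! ### Comparison of matrix norms -/

/-- All matrix amplifications of `f` are dominated in norm by those of `g`. -/
def MatLE {A : Type*} {X : Type u} {Y : Type v} [NonUnitalCStarAlgebra X]
    [NonUnitalCStarAlgebra Y] (f : A → X) (g : A → Y) : Prop :=
  ∀ (k : ℕ) (m : Matrix (Fin k) (Fin k) A), matNorm (m.map f) ≤ matNorm (m.map g)

namespace MatLE

variable {A : Type*} {X : Type u} {Y : Type v} {Z : Type w} [NonUnitalCStarAlgebra X]
  [NonUnitalCStarAlgebra Y] [NonUnitalCStarAlgebra Z]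

theorem trans {f : A → X} {g : A → Y} {h : A → Z} (hfg : MatLE f g) (hgh : MatLE g h) :
    MatLE f h :=
  fun k m => (hfg k m).trans (hgh k m)

theorem comp {B : Type*} {f : A → X} {g : A → Y} (hfg : MatLE f g) (e : B → A) :
    MatLE (fun b => f (e b)) (fun b => g (e b)) :=
  fun k m => by simpa [Matrix.map_map] using! hfg k (m.map e)

theorem map (φ : X →⋆ₙₐ[ℂ] Y) (f : A → X) : MatLE (fun a => φ (f a)) f :=
  fun _ m => matNorm_map_le φ (m.map f)

/-- An injective *-homomorphism remains injective on matrices, and is therefore isometric there. -/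
theorem of_map (φ : X →⋆ₙₐ[ℂ] Y) (hφ : Function.Injective φ) (f : A → X) :
    MatLE f (fun a => φ (f a)) := by
  intro k m
  let _ := CStarAlgebra.spectralOrder X
  have _ := CStarAlgebra.spectralOrderedRing X
  let _ := CStarAlgebra.spectralOrder Y
  have _ := CStarAlgebra.spectralOrderedRing Y
  refine (NonUnitalStarAlgHom.norm_map (CStarMatrix.mapₙₐ (n := Fin k) φ) ?_
    (CStarMatrix.ofMatrix (m.map f))).symm.le
  intro x y hxy
  ext i j
  exact hφ (congrFun (congrFun hxy i) j)

/-- The embedding of `X` in the matrices over `X` as the scalar matrices. -/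
def diagHom (X : Type u) [NonUnitalCStarAlgebra X] (J : Type*) [Fintype J] [DecidableEq J] :
    X →⋆ₙₐ[ℂ] CStarMatrix J J X where
  toFun x := CStarMatrix.ofMatrix (Matrix.diagonal fun _ => x)
  map_smul' c x := by
    ext i j
    by_cases h : i = j <;> simp [h]
  map_zero' := by
    ext i j
    by_cases h : i = j <;> simp [h]
  map_add' x y := by
    ext i j
    by_cases h : i = j <;> simp [h]
  map_mul' x y := by
    ext i j
    by_cases h : i = j <;> simp [h, CStarMatrix.mul_apply, Matrix.diagonal_apply, ite_mul]
  map_star' x := by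
    ext i j
    by_cases h : i = j <;> simp [h, CStarMatrix.star_apply, eq_comm]

/-- On matrices the conjugation is by the diagonal matrix with all entries `c`, which is again a
contraction. -/
theorem conj (g : A → Y) {c : Y} (hc : ‖c‖ ≤ 1) : MatLE (fun a => c * g a * star c) g := by
  intro k m
  let _ := CStarAlgebra.spectralOrder Y
  have _ := CStarAlgebra.spectralOrderedRing Y
  have h1 : ‖diagHom Y (Fin k) c‖ ≤ 1 := (NonUnitalStarAlgHom.norm_apply_le _ c).trans hc
  have h2 : CStarMatrix.ofMatrix (m.map fun a => c * g a * star c) =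
      diagHom Y (Fin k) c * CStarMatrix.ofMatrix (m.map g) * star (diagHom Y (Fin k) c) := by
    ext i j
    simp [diagHom, CStarMatrix.mul_apply, CStarMatrix.star_apply, Matrix.diagonal_apply, ite_mul,
      apply_ite star]
  change ‖CStarMatrix.ofMatrix (m.map fun a => c * g a * star c)‖ ≤
    ‖CStarMatrix.ofMatrix (m.map g)‖
  rw [h2]
  calc _ ≤ ‖diagHom Y (Fin k) c‖ * ‖CStarMatrix.ofMatrix (m.map g)‖ *
        ‖star (diagHom Y (Fin k) c)‖ :=
        (norm_mul_le _ _).trans (by gcongr; exact norm_mul_le _ _)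
    _ ≤ 1 * ‖CStarMatrix.ofMatrix (m.map g)‖ * 1 := by
        rw [norm_star]
        gcongr
    _ = _ := by ring

/-- The common source of complete contractivity below: after a faithful embedding the map is a
conjugation by a contraction. It serves for rows over `X` and for compressions of operators. -/
theorem of_conj {f : A → X} {g : A → Y} (φ : X →⋆ₙₐ[ℂ] Y) (hφ : Function.Injective φ) {c : Y}
    (hc : ‖c‖ ≤ 1) (h : ∀ a, φ (f a) = c * g a * star c) : MatLE f g := by
  refine (of_map φ hφ f).trans ?_
  simp only [h]
  exact conj g hc

theorem of_tendsto {I : Type*} {l : Filter I} [l.NeBot] {f : I → A → X} {f₀ : A → X} {g : A → Y}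
    (hf : ∀ i, MatLE (f i) g) (h : ∀ a, Filter.Tendsto (fun i => f i a) l (nhds (f₀ a))) :
    MatLE f₀ g := by
  intro k m
  let _ := CStarAlgebra.spectralOrder X
  have _ := CStarAlgebra.spectralOrderedRing X
  have hlim : Filter.Tendsto (fun i => CStarMatrix.ofMatrix (m.map (f i))) l
      (nhds (CStarMatrix.ofMatrix (m.map f₀))) := by
    refine tendsto_pi_nhds.2 fun i => tendsto_pi_nhds.2 fun j => ?_
    exact h (m i j)
  exact le_of_tendsto hlim.norm (Filter.Eventually.of_forall fun i => hf i k m)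

/-! ### Conjugation of scalar matrices by a contractive row -/

/-- The map with image in the corner `(j, j)` of the matrices. -/
def cornerHom (X : Type u) [NonUnitalCStarAlgebra X] {J : Type*} [Fintype J] [DecidableEq J]
    (j : J) : X →⋆ₙₐ[ℂ] CStarMatrix J J X where
  toFun x := CStarMatrix.ofMatrix (Matrix.single j j x)
  map_smul' c x := by
    ext i k
    simp [Matrix.single_apply]
  map_zero' := by
    ext i k
    simp
  map_add' x y := by
    ext i k
    simp [Matrix.single_add]
  map_mul' x y := by
    ext i k
    simp only [CStarMatrix.mul_apply, CStarMatrix.ofMatrix_apply, Matrix.single_apply, ite_mul,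
      mul_ite, zero_mul, mul_zero, ite_and]
    by_cases h1 : j = i <;> by_cases h2 : j = k <;> simp [h1, h2]
  map_star' x := by
    ext i k
    simp only [CStarMatrix.star_apply, CStarMatrix.ofMatrix_apply, Matrix.single_apply, and_comm,
      apply_ite star, star_zero]

theorem cornerHom_injective {J : Type*} [Fintype J] [DecidableEq J] (j : J) :
    Function.Injective (cornerHom X j) := by
  intro x y hxy
  have := congrFun (congrFun hxy j) j
  simpa [cornerHom] using! this

/-- The embedding `b ↦ b ⊗ q` of the scalar matrices, for a projection `q`. -/
def tensorHom {J : Type*} [Fintype J] [DecidableEq J] {q : X} (hq : q * q = q)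
    (hs : star q = q) : Matrix J J ℂ →⋆ₙₐ[ℂ] CStarMatrix J J X where
  toFun b := CStarMatrix.ofMatrix (b.map fun t => t • q)
  map_smul' c x := by
    ext i k
    simp [mul_smul]
  map_zero' := by
    ext i k
    simp
  map_add' x y := by
    ext i k
    simp [add_smul]
  map_mul' x y := by
    ext i k
    simp [CStarMatrix.mul_apply, Matrix.mul_apply, Finset.sum_smul, smul_mul_smul_comm, hq]
  map_star' x := by
    ext i k
    simp [CStarMatrix.star_apply, hs]

/-- The square matrix with row `V` at the place `j₀` and zero rows elsewhere. -/
def rowMatrix {J : Type*} [DecidableEq J] (j₀ : J) (V : J → X) : CStarMatrix J J X :=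
  CStarMatrix.ofMatrix (Matrix.of fun i j => if i = j₀ then V j else 0)

theorem rowMatrix_apply {J : Type*} [DecidableEq J] (j₀ : J) (V : J → X) (i j : J) :
    rowMatrix j₀ V i j = if i = j₀ then V j else 0 := rfl

theorem cornerHom_apply {J : Type*} [Fintype J] [DecidableEq J] (j : J) (x : X) (i k : J) :
    cornerHom X j x i k = if i = j ∧ k = j then x else 0 := by
  simp [cornerHom, Matrix.single_apply, eq_comm]

theorem tensorHom_apply {J : Type*} [Fintype J] [DecidableEq J] {q : X} (hq : q * q = q)
    (hs : star q = q) (b : Matrix J J ℂ) (i k : J) : tensorHom hq hs b i k = b i k • q := rfl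

/-- Padding the row with zero rows makes it an element of the C*-algebra of square matrices. Its
norm can then be read off from the corner by the C*-identity. -/
theorem cornerHom_sum_mul_star {J : Type*} [Fintype J] [DecidableEq J] (j₀ : J) (V : J → X) :
    cornerHom X j₀ (∑ j, V j * star (V j)) = rowMatrix j₀ V * star (rowMatrix j₀ V) := by
  ext i k
  simp only [cornerHom_apply, CStarMatrix.mul_apply, CStarMatrix.star_apply, rowMatrix_apply]
  by_cases hi : i = j₀ <;> by_cases hk : k = j₀ <;>
    simp [hi, hk]

theorem cornerHom_sum_smul {J : Type*} [Fintype J] [DecidableEq J] {q : X}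
    (hq : q * q = q) (hs : star q = q) {V : J → X} (hV : ∀ j, V j * q = V j) (j₀ : J)
    (b : Matrix J J ℂ) :
    cornerHom X j₀ (∑ j, ∑ k, b j k • (V j * star (V k))) =
      rowMatrix j₀ V * tensorHom hq hs b * star (rowMatrix j₀ V) := by
  ext i k
  simp only [cornerHom_apply, CStarMatrix.mul_apply, CStarMatrix.star_apply, rowMatrix_apply,
    tensorHom_apply]
  by_cases hi : i = j₀ <;> by_cases hk : k = j₀ <;>
    simp [hi, hk, Finset.sum_mul, smul_mul_assoc, mul_smul_comm, hV]
  rw [Finset.sum_comm]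

theorem norm_rowMatrix_le [PartialOrder X] [StarOrderedRing X] {J : Type*} [Fintype J]
    [DecidableEq J] (j₀ : J) {V : J → X} (h1 : ‖∑ j, V j * star (V j)‖ ≤ 1) :
    ‖rowMatrix j₀ V‖ ≤ 1 := by
  have : ‖rowMatrix j₀ V‖ * ‖rowMatrix j₀ V‖ ≤ 1 := by
    rw [← CStarRing.norm_self_mul_star, ← cornerHom_sum_mul_star]
    exact (NonUnitalStarAlgHom.norm_apply_le _ _).trans h1
  nlinarith [norm_nonneg (rowMatrix j₀ V)]

/-- The map factors as the *-homomorphism `b ↦ b ⊗ q` followed by conjugation with the padded row.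
The projection `q` replaces the unit that `X` may lack, and `V j * q = V j` makes it invisible in
the formula. -/
theorem sum_smul_mul_star_of_order [PartialOrder X] [StarOrderedRing X] {J : Type*} [Fintype J]
    [DecidableEq J] (j₀ : J) {q : X} (hq : q * q = q) (hs : star q = q) {V : J → X}
    (hV : ∀ j, V j * q = V j) (h1 : ‖∑ j, V j * star (V j)‖ ≤ 1) :
    MatLE (fun b : Matrix J J ℂ => ∑ j, ∑ k, b j k • (V j * star (V k)))
      (fun b : Matrix J J ℂ => b) := by
  have h2 : MatLE (fun b : Matrix J J ℂ => ∑ j, ∑ k, b j k • (V j * star (V k)))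
      (fun b : Matrix J J ℂ => tensorHom (J := J) hq hs b) :=
    of_conj (cornerHom X j₀) (cornerHom_injective j₀) (norm_rowMatrix_le j₀ h1)
      (cornerHom_sum_smul hq hs hV j₀)
  have h3 (φ : Matrix J J ℂ →⋆ₙₐ[ℂ] CStarMatrix J J X) :
      MatLE (fun b : Matrix J J ℂ => φ b) (fun b => b) := MatLE.map φ fun b => b
  exact h2.trans (h3 (tensorHom hq hs))

/-- The map `b ↦ V (b ⊗ 1) V*` on scalar matrices, for a contractive row `V`, is completely
contractive. -/
theorem sum_smul_mul_star {J : Type*} [Fintype J] [DecidableEq J] [Nonempty J] {q : X}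
    (hq : q * q = q) (hs : star q = q) {V : J → X} (hV : ∀ j, V j * q = V j)
    (h1 : ‖∑ j, V j * star (V j)‖ ≤ 1) :
    MatLE (fun b : Matrix J J ℂ => ∑ j, ∑ k, b j k • (V j * star (V k)))
      (fun b : Matrix J J ℂ => b) :=
  @sum_smul_mul_star_of_order X _ (CStarAlgebra.spectralOrder X)
    (CStarAlgebra.spectralOrderedRing X) J _ _ (Classical.arbitrary J) q hq hs V hV h1

end MatLE

/-! ### Representations as limits of completely contractive maps -/

open Filter Topology in
/-- `z` is the limit of the multipliers by which left multiplication with `a` acts on the values of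
the maps `f i`, which are asymptotically supported by `q`. -/
structure IsLeftLimit {M : Type u} [CStarAlgebra M] (A : Subalgebra ℂ M) {X : Type v}
    [NonUnitalCStarAlgebra X] {I : Type*} (l : Filter I) (f : I → M →ₗ[ℂ] X) (q : X) (a : M)
    (z : X) : Prop where
  mul_right : z * q = z
  tendsto : ∀ b ∈ A, Tendsto (fun i => f i (a * b) - z * f i b) l (𝓝 0)

namespace IsLeftLimit

open Filter Topology

variable {M : Type u} [CStarAlgebra M] {A : Subalgebra ℂ M} {X : Type v}
  [NonUnitalCStarAlgebra X] {I : Type*} {l : Filter I} {f : I → M →ₗ[ℂ] X} {q : X}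

theorem add {a b : M} {y z : X} (ha : IsLeftLimit A l f q a y) (hb : IsLeftLimit A l f q b z) :
    IsLeftLimit A l f q (a + b) (y + z) where
  mul_right := by rw [add_mul, ha.mul_right, hb.mul_right]
  tendsto c hc := by
    have := (ha.tendsto c hc).add (hb.tendsto c hc)
    rw [add_zero] at this
    refine this.congr fun i => ?_
    rw [add_mul, add_mul, map_add]
    abel

theorem smul (t : ℂ) {a : M} {y : X} (ha : IsLeftLimit A l f q a y) :
    IsLeftLimit A l f q (t • a) (t • y) where
  mul_right := by rw [smul_mul_assoc, ha.mul_right]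
  tendsto c hc := by
    have := (ha.tendsto c hc).const_smul t
    rw [smul_zero] at this
    refine this.congr fun i => ?_
    rw [smul_mul_assoc, smul_mul_assoc, map_smul, smul_sub]

/-- The limit condition for `a` is applied to the element `b * c` of `A`; this is why the condition
quantifies over all of `A` and not only over `1`. -/
theorem mul {a b : M} {y z : X} (ha : IsLeftLimit A l f q a y) (hb : IsLeftLimit A l f q b z)
    (hbA : b ∈ A) : IsLeftLimit A l f q (a * b) (y * z) where
  mul_right := by rw [mul_assoc, hb.mul_right]
  tendsto c hc := by
    have := (ha.tendsto (b * c) (A.mul_mem hbA hc)).add ((hb.tendsto c hc).const_mul y)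
    rw [mul_zero, add_zero] at this
    refine this.congr fun i => ?_
    rw [mul_assoc, mul_assoc, mul_sub]
    abel

theorem sub {a b : M} {y z : X} (ha : IsLeftLimit A l f q a y) (hb : IsLeftLimit A l f q b z) :
    IsLeftLimit A l f q (a - b) (y - z) := by
  have := ha.add (hb.smul (-1))
  simpa [sub_eq_add_neg] using this

/-- Take `b = 1` in the limit condition: `z * f i 1` tends to `z * q = z`. In particular the
multiplier `z` is unique and inherits norm bounds from the `f i`. -/
theorem tendsto_apply {a : M} {z : X} (h : IsLeftLimit A l f q a z)
    (h1 : Tendsto (fun i => f i 1) l (𝓝 q)) : Tendsto (fun i => f i a) l (𝓝 z) := by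
  have := (h.tendsto 1 A.one_mem).add (h1.const_mul z)
  rw [h.mul_right, zero_add] at this
  refine this.congr fun i => ?_
  rw [mul_one, sub_add_cancel]

theorem norm_le [l.NeBot] (hf : ∀ i a, ‖f i a‖ ≤ ‖a‖) (h1 : Tendsto (fun i => f i 1) l (𝓝 q))
    {a : M} {z : X} (h : IsLeftLimit A l f q a z) : ‖z‖ ≤ ‖a‖ :=
  le_of_tendsto (h.tendsto_apply h1).norm (Eventually.of_forall fun i => hf i a)

theorem one (hqq : q * q = q) (hq : ∀ i a, q * f i a = f i a) : IsLeftLimit A l f q 1 q where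
  mul_right := hqq
  tendsto c _ := by simp [hq, tendsto_const_nhds]

theorem exists_of_mem_adjoin {κ : Type*} {g : κ → M} {y : κ → X} (hgA : ∀ k, g k ∈ A)
    (hqq : q * q = q) (hq : ∀ i a, q * f i a = f i a)
    (hg : ∀ k, IsLeftLimit A l f q (g k) (y k)) {a : M}
    (ha : a ∈ Algebra.adjoin ℂ (Set.range g)) : ∃ z, IsLeftLimit A l f q a z := by
  have hle : Algebra.adjoin ℂ (Set.range g) ≤ A :=
    Algebra.adjoin_le (by rintro _ ⟨k, rfl⟩; exact hgA k)
  induction ha using Algebra.adjoin_induction with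
  | mem x hx =>
    obtain ⟨k, rfl⟩ := hx
    exact ⟨_, hg k⟩
  | algebraMap t => exact ⟨_, by simpa [Algebra.algebraMap_eq_smul_one] using (one hqq hq).smul t⟩
  | add x y _ _ hx hy =>
    obtain ⟨u, hu⟩ := hx
    obtain ⟨v, hv⟩ := hy
    exact ⟨_, hu.add hv⟩
  | mul x y _ hyA hx hy =>
    obtain ⟨u, hu⟩ := hx
    obtain ⟨v, hv⟩ := hy
    exact ⟨_, hu.mul hv (hle hyA)⟩

/-- Multipliers are bounded by the norm of the element and depend linearly on it, so those of a
convergent sequence are Cauchy. Their limit is the multiplier of the limit because the `f i` are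
contractive uniformly in `i`. -/
theorem exists_of_mem_closure [l.NeBot] (hf : ∀ i a, ‖f i a‖ ≤ ‖a‖)
    (h1 : Tendsto (fun i => f i 1) l (𝓝 q)) {S : Set M} (hS : ∀ a ∈ S, ∃ z, IsLeftLimit A l f q a z)
    {a : M} (ha : a ∈ closure S) : ∃ z, IsLeftLimit A l f q a z := by
  obtain ⟨s, hs, hlim⟩ := mem_closure_iff_seq_limit.1 ha
  choose z hz using fun k => hS (s k) (hs k)
  have hcau : CauchySeq z := by
    have hcs := hlim.cauchySeq
    rw [Metric.cauchySeq_iff] at hcs ⊢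
    intro ε hε
    obtain ⟨N, hN⟩ := hcs ε hε
    refine ⟨N, fun m hm k hk => lt_of_le_of_lt ?_ (hN m hm k hk)⟩
    rw [dist_eq_norm, dist_eq_norm]
    exact ((hz m).sub (hz k)).norm_le hf h1
  obtain ⟨y, hy⟩ := cauchySeq_tendsto_of_complete hcau
  refine ⟨y, ?_, fun b hb => ?_⟩
  · refine tendsto_nhds_unique ?_ hy
    exact (hy.mul_const q).congr fun k => (hz k).mul_right
  · rw [Metric.tendsto_nhds]
    intro ε hε
    have hlim' : Tendsto (fun k => ‖a - s k‖ * ‖b‖ + ‖z k - y‖ * ‖b‖) atTop (𝓝 0) := by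
      have e1 : Tendsto (fun k => ‖a - s k‖) atTop (𝓝 0) := by
        simpa using (tendsto_const_nhds.sub hlim).norm (a := a - a)
      have e2 : Tendsto (fun k => ‖z k - y‖) atTop (𝓝 0) := by
        simpa using (hy.sub_const y).norm
      simpa using (e1.mul_const ‖b‖).add (e2.mul_const ‖b‖)
    -- The index `k` is fixed first, with an error independent of `i`; only then does `i` move along
    -- `l`.
    obtain ⟨k, hk⟩ := (hlim'.eventually (gt_mem_nhds (half_pos hε))).exists
    have h3 := (Metric.tendsto_nhds.1 ((hz k).tendsto b hb)) (ε / 2) (half_pos hε)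
    filter_upwards [h3] with i hi
    rw [dist_zero_right] at hi ⊢
    have hdec : f i (a * b) - y * f i b =
        f i ((a - s k) * b) + (f i (s k * b) - z k * f i b) + (z k - y) * f i b := by
      rw [sub_mul, map_sub, sub_mul]
      abel
    rw [hdec]
    have n1 : ‖f i ((a - s k) * b)‖ ≤ ‖a - s k‖ * ‖b‖ := (hf _ _).trans (norm_mul_le _ _)
    have n2 : ‖(z k - y) * f i b‖ ≤ ‖z k - y‖ * ‖b‖ :=
      (norm_mul_le _ _).trans (by gcongr; exact hf _ _)
    have n3 := norm_add₃_le (a := f i ((a - s k) * b)) (b := f i (s k * b) - z k * f i b)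
      (c := (z k - y) * f i b)
    linarith

end IsLeftLimit

theorem MatLE.norm_le {A : Type*} {X : Type u} {Y : Type v} [NonUnitalCStarAlgebra X]
    [NonUnitalCStarAlgebra Y] {f : A → X} {g : A → Y} (h : MatLE f g) (a : A) : ‖f a‖ ≤ ‖g a‖ :=
  (norm_le_matNorm (f a)).trans ((h 1 fun _ _ => a).trans (matNorm_le_norm (g a)))

open Filter Topology in
/-- Completely contractive linear maps `f i` for which left multiplication by each of the
generators of `A` is asymptotically left multiplication by an element of `X` converge on `A` to a
completely contractive representation. -/
theorem exists_isCCRep_of_tendsto {M : Type u} [CStarAlgebra M] {A : Subalgebra ℂ M} {X : Type v}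
    [NonUnitalCStarAlgebra X] {I : Type*} {l : Filter I} [l.NeBot] {f : I → M →ₗ[ℂ] X} {q : X}
    {κ : Type*} {g : κ → M} {y : κ → X} (hgA : ∀ k, g k ∈ A)
    (hA : (A : Set M) ⊆ closure (Algebra.adjoin ℂ (Set.range g)))
    (hf : ∀ i, MatLE (f i) fun a : M => a) (hq : ∀ i a, q * f i a = f i a)
    (h1 : Tendsto (fun i => f i 1) l (𝓝 q)) (hyq : ∀ k, y k * q = y k)
    (hy : ∀ k, ∀ a ∈ A, Tendsto (fun i => f i (g k * a) - y k * f i a) l (𝓝 0)) :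
    ∃ ρ : A → X, IsCCRep A ρ ∧ ∀ k, ρ ⟨g k, hgA k⟩ = y k := by
  have hn : ∀ i a, ‖f i a‖ ≤ ‖a‖ := fun i a => (hf i).norm_le a
  -- `q * f i 1 = f i 1` passes to the limit.
  have hqq : q * q = q := by
    refine tendsto_nhds_unique (h1.const_mul q) ?_
    simpa only [hq] using h1
  have hex : ∀ a : A, ∃ z, IsLeftLimit A l f q (a : M) z := fun a =>
    IsLeftLimit.exists_of_mem_closure hn h1
      (fun b hb => IsLeftLimit.exists_of_mem_adjoin hgA hqq hq (fun k => ⟨hyq k, hy k⟩) hb)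
      (hA a.2)
  have huniq : ∀ {a : M} {z z' : X}, IsLeftLimit A l f q a z → IsLeftLimit A l f q a z' →
      z = z' := fun h h' => tendsto_nhds_unique (h.tendsto_apply h1) (h'.tendsto_apply h1)
  choose ρ hρ using hex
  refine ⟨ρ, ⟨fun a b => huniq (hρ _) ((hρ a).add (hρ b)),
    fun t a => huniq (hρ _) ((hρ a).smul t),
    fun a b => huniq (hρ _) ((hρ a).mul (hρ b) b.2), ?_⟩,
    fun k => huniq (hρ _) ⟨hyq k, hy k⟩⟩
  -- The multiplier of `a` is also the norm limit of the values `f i a`, so bounds on matrix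
  -- amplifications survive.
  exact MatLE.of_tendsto (f := fun i (a : A) => f i (a : M))
    (fun i => (hf i).comp fun a : A => (a : M)) fun a => (hρ a).tendsto_apply h1

/-! ### Projections and defects -/

/-- A family of mutually orthogonal (selfadjoint) projections. -/
structure IsProjFamily {X : Type u} [NonUnitalCStarAlgebra X] {B : Type*} (q : B → X) : Prop where
  star_eq : ∀ b, star (q b) = q b
  mul_self : ∀ b, q b * q b = q b
  mul_of_ne : ∀ b c, b ≠ c → q b * q c = 0

theorem norm_le_one_of_projection {X : Type u} [NonUnitalCStarAlgebra X] {q : X}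
    (hs : star q = q) (hq : q * q = q) : ‖q‖ ≤ 1 := by
  have h : ‖q‖ = ‖q‖ * ‖q‖ := by
    conv_lhs => rw [← hq]
    nth_rw 1 [← hs]
    exact CStarRing.norm_star_mul_self
  by_contra! h1
  nlinarith

namespace IsProjFamily

variable {X : Type u} [NonUnitalCStarAlgebra X] {B : Type*} {q : B → X}

theorem mul_eq_zero (hq : IsProjFamily q) {b c : B} (h : b ≠ c) {x : X} (hx : q c * x = x) :
    q b * x = 0 := by
  rw [← hx, ← mul_assoc, hq.mul_of_ne b c h, zero_mul]

variable [Fintype B]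

theorem star_sum (hq : IsProjFamily q) : star (∑ b, q b) = ∑ b, q b := by
  rw [_root_.star_sum]
  exact Finset.sum_congr rfl fun b _ => hq.star_eq b

theorem sum_mul (hq : IsProjFamily q) {c : B} {x : X} (hx : q c * x = x) :
    (∑ b, q b) * x = x := by
  rw [Finset.sum_mul, Finset.sum_eq_single c (fun b _ h => hq.mul_eq_zero h hx) (by simp), hx]

theorem mul_sum (hq : IsProjFamily q) {c : B} {x : X} (hx : x * q c = x) :
    x * (∑ b, q b) = x := by
  apply star_injective
  rw [star_mul, hq.star_sum]
  refine hq.sum_mul (c := c) ?_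
  nth_rw 1 [← hq.star_eq c]
  rw [← star_mul, hx]

theorem sum_mul_sum (hq : IsProjFamily q) : (∑ b, q b) * (∑ b, q b) = ∑ b, q b := by
  conv_lhs => rw [Finset.mul_sum]
  exact Finset.sum_congr rfl fun b _ => hq.sum_mul (hq.mul_self b)

theorem norm_sum_le (hq : IsProjFamily q) : ‖∑ b, q b‖ ≤ 1 :=
  norm_le_one_of_projection hq.star_sum hq.sum_mul_sum

end IsProjFamily

/-- Since `x = q * x`, conjugating by `q` gives `x * star x ≤ ‖x * star x‖ • q ≤ q`, and a positive
element is the square of a selfadjoint one. This is the defect operator of `x` relative to `q`; its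
positivity is not needed. -/
theorem exists_defect {X : Type u} [NonUnitalCStarAlgebra X] {q x : X} (hs : star q = q)
    (hq : q * q = q) (hqx : q * x = x) (hx : ‖x‖ ≤ 1) :
    ∃ d, star d = d ∧ d * d = q - x * star x ∧ q * d = d ∧ ‖d‖ ≤ 2 := by
  let _ := CStarAlgebra.spectralOrder X
  have _ := CStarAlgebra.spectralOrderedRing X
  have hxq : star x * q = star x := by
    nth_rw 1 [← hs]
    rw [← star_mul, hqx]
  have h0 : 0 ≤ q - x * star x := by
    have h1 : star q * (x * star x) * q ≤ ‖x * star x‖ • (star q * q) :=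
      CStarAlgebra.star_left_conjugate_le_norm_smul (IsSelfAdjoint.mul_star_self x)
    have h2 : star q * (x * star x) * q = x * star x := by
      rw [hs, ← mul_assoc, hqx, mul_assoc, hxq]
    have h3 : ‖x * star x‖ ≤ 1 := by
      rw [CStarRing.norm_self_mul_star]
      nlinarith [norm_nonneg x]
    have h4 : ‖x * star x‖ • (star q * q) ≤ star q * q := by
      simpa using smul_le_smul_of_nonneg_right h3 (star_mul_self_nonneg q)
    rw [h2] at h1
    rw [hs, hq] at h4
    rw [hs, hq] at h1
    exact sub_nonneg.2 (h1.trans h4)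
  obtain ⟨d, hd, hdd⟩ := CStarAlgebra.nonneg_iff_exists_isSelfAdjoint_and_eq_mul_self.1 h0
  have hd' : star d = d := hd
  refine ⟨d, hd, hdd.symm, ?_, ?_⟩
  · have hqe : q * (d * d) = d * d := by
      rw [← hdd, mul_sub, hq, ← mul_assoc, hqx]
    have heq : (d * d) * q = d * d := by
      rw [← hdd, sub_mul, hq, mul_assoc, hxq]
    -- `q` fixes `d * d` from both sides, so the four terms cancel, and the C*-identity transfers
    -- the invariance from `d * d` to `d`.
    have h5 : (d - q * d) * star (d - q * d) = 0 := by
      rw [star_sub, star_mul, hd', hs, sub_mul, mul_sub, mul_sub]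
      have e1 : d * (d * q) = d * d := by rw [← mul_assoc, heq]
      have e2 : q * d * d = d * d := by rw [mul_assoc, hqe]
      have e3 : q * d * (d * q) = d * d := by rw [← mul_assoc, e2, heq]
      rw [e1, e2, e3]
      simp
    exact (sub_eq_zero.1 ((CStarRing.mul_star_self_eq_zero_iff _).1 h5)).symm
  -- The triangle inequality suffices: any bound on `‖d‖` independent of `x` will do later.
  · have h6 : ‖d‖ * ‖d‖ ≤ 2 := by
      rw [← CStarRing.norm_self_mul_star, hd', ← hdd]
      refine (norm_sub_le _ _).trans ?_
      rw [CStarRing.norm_self_mul_star]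
      nlinarith [norm_le_one_of_projection hs hq, norm_nonneg x]
    nlinarith [norm_nonneg d]

/-- The product `x b * x (s b) * ⋯ * x (s^(k-1) b) * d (s^k b)`. -/
def chainProd {X : Type*} [Mul X] {B : Type*} (s : B → B) (x d : B → X) : ℕ → B → X
  | 0, b => d b
  | k + 1, b => x b * chainProd s x d k (s b)

section Chain

variable {X : Type u} [NonUnitalCStarAlgebra X] {B : Type*} {s : B → B} {q x d : B → X}

theorem mul_chainProd (hx : ∀ b, q b * x b = x b) (hd : ∀ b, q b * d b = d b) (k : ℕ) (b : B) :
    q b * chainProd s x d k b = chainProd s x d k b := by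
  cases k with
  | zero => exact hd b
  | succ k => rw [chainProd, ← mul_assoc, hx]

theorem chainProd_mul {p : X} (hd : ∀ b, d b * p = d b) (k : ℕ) (b : B) :
    chainProd s x d k b * p = chainProd s x d k b := by
  induction k generalizing b with
  | zero => exact hd b
  | succ k ih => rw [chainProd, mul_assoc, ih]

theorem norm_chainProd_le {r C : ℝ} (hx : ∀ b, ‖x b‖ ≤ r) (hd : ∀ b, ‖d b‖ ≤ C) (k : ℕ) (b : B) :
    ‖chainProd s x d k b‖ ≤ r ^ k * C := by
  induction k generalizing b with
  | zero => simpa [chainProd] using hd b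
  | succ k ih =>
    have hr : 0 ≤ r := (norm_nonneg _).trans (hx b)
    calc ‖chainProd s x d (k + 1) b‖ ≤ ‖x b‖ * ‖chainProd s x d k (s b)‖ := norm_mul_le _ _
      _ ≤ r * (r ^ k * C) := by
        gcongr
        exacts [hx b, ih _]
      _ = _ := by ring

/-- The sum of the positive elements defined by the chains with end factor the defect of `x`
telescopes. -/
theorem sum_chainProd_mul_star (hx : ∀ b, x b * q (s b) = x b)
    (hd : ∀ b, d b * star (d b) = q b - x b * star (x b)) (m : ℕ) (b : B) :
    ∑ k ∈ Finset.range (m + 1), chainProd s x d k b * star (chainProd s x d k b) =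
      q b - chainProd s x x m b * star (chainProd s x x m b) := by
  induction m generalizing b with
  | zero => simpa [chainProd] using hd b
  | succ m ih =>
    -- The chain of length zero is split off; all the others share the outer factors `x b` and `star
    -- (x b)`, so the induction hypothesis applies at `s b`.
    rw [Finset.sum_range_succ']
    have h (k : ℕ) : chainProd s x d (k + 1) b * star (chainProd s x d (k + 1) b) =
        x b * (chainProd s x d k (s b) * star (chainProd s x d k (s b))) * star (x b) := by
      simp only [chainProd, star_mul, mul_assoc]
    simp only [h]
    rw [← Finset.sum_mul, ← Finset.mul_sum, ih, mul_sub, hx]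
    simp only [chainProd, hd, star_mul, mul_assoc, sub_mul]
    abel

end Chain

/-! ### Representations of algebras of matrices -/

/-- The embedding `a ↦ a ⊗ 1`. -/
def ampHom (n L : Type*) [Fintype n] [DecidableEq n] [Fintype L] [DecidableEq L] :
    Matrix n n ℂ →⋆ₙₐ[ℂ] Matrix (n × L) (n × L) ℂ where
  toFun a := Matrix.kronecker a (1 : Matrix L L ℂ)
  map_smul' c a := Matrix.smul_kronecker c a 1
  map_zero' := Matrix.zero_kronecker _
  map_add' a b := Matrix.add_kronecker a b 1
  map_mul' a b := by
    conv_lhs => rw [← mul_one (1 : Matrix L L ℂ)]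
    exact Matrix.mul_kronecker_mul a b 1 1
  map_star' a := by
    refine Eq.trans ?_ (Matrix.conjTranspose_kronecker a (1 : Matrix L L ℂ)).symm
    rw [Matrix.conjTranspose_one]
    rfl

/-- The linear map `a ↦ V (a ⊗ 1) V*` on matrices. -/
def conjMap {X : Type u} [NonUnitalCStarAlgebra X] {n L : Type*} [Fintype n] [Fintype L]
    (V : n → L → X) : Matrix n n ℂ →ₗ[ℂ] X where
  toFun a := ∑ j, ∑ c, a j c • ∑ l, V j l * star (V c l)
  map_add' a b := by simp [add_smul, Finset.sum_add_distrib]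
  map_smul' t a := by simp [mul_smul, Finset.smul_sum]

theorem conjMap_apply {X : Type u} [NonUnitalCStarAlgebra X] {n L : Type*} [Fintype n] [Fintype L]
    (V : n → L → X) (a : Matrix n n ℂ) :
    conjMap V a = ∑ j, ∑ c, a j c • ∑ l, V j l * star (V c l) := rfl

section Matrix

variable {X : Type u} [NonUnitalCStarAlgebra X] {n L : Type*} [Fintype n] [DecidableEq n]
  [Fintype L]

/-- With rows indexed by `n × L`, this is conjugation of `a ⊗ 1` by one long contractive row, and `a
↦ a ⊗ 1` is a *-homomorphism. -/
theorem matLE_conjMap [DecidableEq L] [Nonempty n] [Nonempty L] {p : X} (hp : p * p = p)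
    (hs : star p = p) {V : n → L → X} (hV : ∀ j l, V j l * p = V j l)
    (h1 : ‖∑ j, ∑ l, V j l * star (V j l)‖ ≤ 1) :
    MatLE (conjMap V) fun a : Matrix n n ℂ => a := by
  have h2 := (MatLE.sum_smul_mul_star (J := n × L) hp hs (V := fun w => V w.1 w.2)
    (fun w => hV _ _) (by rwa [Fintype.sum_prod_type])).comp (ampHom n L)
  have h3 (φ : Matrix n n ℂ →⋆ₙₐ[ℂ] Matrix (n × L) (n × L) ℂ) :
      MatLE (fun a : Matrix n n ℂ => φ a) (fun a => a) := MatLE.map φ fun a => a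
  refine MatLE.trans ?_ (h2.trans (h3 (ampHom n L)))
  refine fun k m => le_of_eq (congrArg (fun F : Matrix n n ℂ → X => matNorm (m.map F)) ?_)
  funext a
  simp only [conjMap_apply, Fintype.sum_prod_type]
  refine Finset.sum_congr rfl fun j _ => ?_
  rw [Finset.sum_comm]
  refine Finset.sum_congr rfl fun c _ => ?_
  rw [Finset.smul_sum]
  refine Finset.sum_congr rfl fun l _ => ?_
  simp [ampHom, Matrix.kroneckerMap_apply, Matrix.one_apply]

/-- Left multiplication by the matrix unit moves row `t` of `a` to row `s`. Together with
`mul_conjMap` this reduces the left module property to a comparison of `V s` with `x * V t`. -/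
theorem conjMap_single_mul (V : n → L → X) (s t : n) (a : Matrix n n ℂ) :
    conjMap V (Matrix.single s t 1 * a) = ∑ c, a t c • ∑ l, V s l * star (V c l) := by
  rw [conjMap_apply, Finset.sum_eq_single s _ (by simp)]
  · simp
  · intro j _ hj
    refine Finset.sum_eq_zero fun c _ => ?_
    rw [Matrix.single_mul_apply_of_ne _ _ _ _ _ hj, zero_smul]

-- The `V j l` lie under the orthogonal projections `q j`, so `x = x * q t` annihilates all but row
-- `t`.
omit [DecidableEq n] in
theorem mul_conjMap {q : n → X} (hq : IsProjFamily q) {V : n → L → X}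
    (hqV : ∀ j l, q j * V j l = V j l) {t : n} {x : X} (hx : x * q t = x) (a : Matrix n n ℂ) :
    x * conjMap V a = ∑ c, a t c • ∑ l, x * V t l * star (V c l) := by
  rw [conjMap_apply, Finset.mul_sum, Finset.sum_eq_single t _ (by simp)]
  · simp only [Finset.mul_sum, mul_smul_comm, mul_assoc]
  · intro j _ hj
    rw [Finset.mul_sum]
    refine Finset.sum_eq_zero fun c _ => ?_
    rw [mul_smul_comm, Finset.mul_sum, Finset.sum_eq_zero, smul_zero]
    intro l _
    rw [← hx, mul_assoc, ← mul_assoc (q t), hq.mul_eq_zero hj.symm (hqV j l), zero_mul, mul_zero]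

/-- A family of projections `q j` and elements `x k = q (s k) * x k * q (t k)` defines a completely
contractive representation of the algebra of matrices generated by the diagonal matrix units and the
matrix units at the places `(s k, t k)`, if there is a matrix `V` whose rows satisfy
`V j * (V j)* = q j` and, as far as the algebra notices, `V (s k) = x k * V (t k)`. -/
theorem exists_isCCRep_of_rows [DecidableEq L] [Nonempty n] [Nonempty L] {A : Subalgebra ℂ (Matrix n n ℂ)}
    {κ : Type*} {s t : κ → n} (hdiag : ∀ j, Matrix.single j j 1 ∈ A)
    (hst : ∀ k, Matrix.single (s k) (t k) 1 ∈ A)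
    (hA : A ≤ Algebra.adjoin ℂ (Set.range (Sum.elim (fun j => Matrix.single j j (1 : ℂ))
      fun k => Matrix.single (s k) (t k) 1)))
    {q : n → X} (hq : IsProjFamily q) {x : κ → X} (hx : ∀ k, x k * q (t k) = x k)
    {V : n → L → X} (hqV : ∀ j l, q j * V j l = V j l) (hVq : ∀ j l, V j l * (∑ i, q i) = V j l)
    (hV : ∀ j, ∑ l, V j l * star (V j l) = q j)
    (hstep : ∀ k, ∀ a ∈ A, ∀ c l, a (t k) c ≠ 0 → V c l ≠ 0 → V (s k) l = x k * V (t k) l) :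
    ∃ ρ : A → X, IsCCRep A ρ ∧ (∀ j, ρ ⟨Matrix.single j j 1, hdiag j⟩ = q j) ∧
      ∀ k, ρ ⟨Matrix.single (s k) (t k) 1, hst k⟩ = x k := by
  have hone : conjMap V 1 = ∑ j, q j := by
    rw [conjMap_apply]
    refine Finset.sum_congr rfl fun j _ => ?_
    rw [Finset.sum_eq_single j (fun c _ hc => by simp [Matrix.one_apply_ne hc.symm]) (by simp)]
    simp [hV]
  have hmem : ∀ k, Sum.elim (fun j => Matrix.single j j (1 : ℂ))
      (fun k => Matrix.single (s k) (t k) 1) k ∈ A := by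
    rintro (j | k)
    exacts [hdiag j, hst k]
  suffices h : ∃ ρ : A → X, IsCCRep A ρ ∧ ∀ k, ρ ⟨_, hmem k⟩ = Sum.elim q x k by
    obtain ⟨ρ, hρ, hρg⟩ := h
    exact ⟨ρ, hρ, fun j => hρg (Sum.inl j), fun k => hρg (Sum.inr k)⟩
  -- A constant family along the one-point filter: the asymptotic conditions are met as exact
  -- identities.
  refine exists_isCCRep_of_tendsto (l := pure ()) (f := fun _ => conjMap V)
    (q := ∑ j, q j) hmem ?_ ?_ ?_ ?_ ?_ ?_
  · exact fun a ha => subset_closure (hA ha)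
  · refine fun _ => matLE_conjMap hq.sum_mul_sum hq.star_sum hVq ?_
    simp only [hV]
    exact hq.norm_sum_le
  · intro _ a
    rw [conjMap_apply]
    simp only [Finset.mul_sum, mul_smul_comm, ← mul_assoc]
    refine Finset.sum_congr rfl fun j _ => Finset.sum_congr rfl fun c _ => ?_
    congr 1
    refine Finset.sum_congr rfl fun l _ => ?_
    rw [hq.sum_mul (hqV j l)]
  · rw [hone]
    exact tendsto_const_nhds
  · rintro (j | k)
    exacts [hq.mul_sum (hq.mul_self j), hq.mul_sum (hx k)]
  · rintro (j | k) a ha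
    · refine tendsto_const_nhds.congr fun _ => (sub_eq_zero.2 ?_).symm
      simp only [Sum.elim_inl]
      rw [conjMap_single_mul, mul_conjMap hq hqV (hq.mul_self j)]
      simp only [hqV]
    · refine tendsto_const_nhds.congr fun _ => (sub_eq_zero.2 ?_).symm
      simp only [Sum.elim_inr]
      rw [conjMap_single_mul, mul_conjMap hq hqV (hx k)]
      refine Finset.sum_congr rfl fun c _ => ?_
      -- Terms with `a (t k) c = 0` or `V c l = 0` vanish on both sides, so the intertwining of rows
      -- is needed only off these cases.
      by_cases hac : a (t k) c = 0
      · simp [hac]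
      · congr 1
        refine Finset.sum_congr rfl fun l _ => ?_
        by_cases hcl : V c l = 0
        · simp [hcl]
        · rw [hstep k a ha c l hac hcl]

end Matrix

theorem single_one_mem_cornerAlg {n : ℕ} (i k j : Fin n) :
    Matrix.single j j (1 : ℂ) ∈ cornerAlg i k := by
  intro r c h _
  refine Matrix.single_apply_of_ne _ _ _ _ _ ?_
  grind

theorem le_of_single_mem {n : Type*} [Fintype n] [DecidableEq n]
    {A S : Subalgebra ℂ (Matrix n n ℂ)}
    (h : ∀ a ∈ A, ∀ j c, a j c ≠ 0 → Matrix.single j c 1 ∈ S) : A ≤ S := by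
  intro a ha
  rw [Matrix.matrix_eq_sum_single a]
  refine S.sum_mem fun j _ => S.sum_mem fun c _ => ?_
  by_cases hjc : a j c = 0
  · rw [hjc, Matrix.single_zero]
    exact S.zero_mem
  · have := S.smul_mem (h a ha j c hjc) (a j c)
    rwa [Matrix.smul_single, smul_eq_mul, mul_one] at this

theorem cornerAlg_le_adjoin {n : ℕ} (i k : Fin n) :
    cornerAlg i k ≤ Algebra.adjoin ℂ (Set.range (Sum.elim
      (fun j => Matrix.single j j (1 : ℂ)) fun _ : Unit => Matrix.single i k 1)) := by
  refine le_of_single_mem fun a ha j c hjc => ?_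
  by_cases h1 : j = c
  · subst h1
    exact Algebra.subset_adjoin ⟨Sum.inl j, rfl⟩
  · by_cases h2 : (j, c) = (i, k)
    · cases h2
      exact Algebra.subset_adjoin ⟨Sum.inr (), rfl⟩
    · exact absurd (ha j c h1 h2) hjc

/-- A representation of `cornerAlg i k` from projections and a contraction. -/
theorem exists_isCCRep_cornerAlg {n : ℕ} {i k : Fin n} (hik : i ≠ k) {X : Type u}
    [NonUnitalCStarAlgebra X] {q : Fin n → X} (hq : IsProjFamily q) {x : X} (hqx : q i * x = x)
    (hxq : x * q k = x) (hx : ‖x‖ ≤ 1) :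
    ∃ ρ : cornerAlg i k → X, IsCCRep (cornerAlg i k) ρ ∧
      (∀ j, ρ ⟨Matrix.single j j 1, single_one_mem_cornerAlg i k j⟩ = q j) ∧
      ρ ⟨Matrix.single i k 1, single_mem_cornerAlg i k 1⟩ = x := by
  obtain ⟨d, hds, hdd, hqd, -⟩ := exists_defect (hq.star_eq i) (hq.mul_self i) hqx hx
  have hdq : d * q i = d := by
    apply star_injective
    rw [star_mul, hds, hq.star_eq, hqd]
  have : Nonempty (Fin n) := ⟨i⟩
  -- Row `i` has `d` in column `i` and `x` in column `k`, so that its square sum is `d * d + x *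
  -- star x = q i`; every other row `j` has just `q j` on the diagonal.
  let V : Fin n → Fin n → X := fun j l =>
    if j = l then (if j = i then d else q j) else if j = i ∧ l = k then x else 0
  have hVj : ∀ j l, j ≠ i → V j l = if j = l then q j else 0 := by
    intro j l hj
    simp [V, hj]
  have hVi : ∀ l, V i l = if l = i then d else if l = k then x else 0 := by
    intro l
    simp [V, eq_comm]
  suffices h : ∃ ρ : cornerAlg i k → X, IsCCRep (cornerAlg i k) ρ ∧
      (∀ j, ρ ⟨Matrix.single j j 1, single_one_mem_cornerAlg i k j⟩ = q j) ∧
      ∀ _ : Unit, ρ ⟨Matrix.single i k 1, single_mem_cornerAlg i k 1⟩ = x by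
    obtain ⟨ρ, h1, h2, h3⟩ := h
    exact ⟨ρ, h1, h2, h3 ()⟩
  refine exists_isCCRep_of_rows (A := cornerAlg i k) (κ := Unit)
    (s := fun _ => i) (t := fun _ => k) (single_one_mem_cornerAlg i k)
    (fun _ => single_mem_cornerAlg i k 1) (cornerAlg_le_adjoin i k) hq (x := fun _ => x)
    (fun _ => hxq) (V := V) ?_ ?_ ?_ ?_
  · intro j l
    by_cases hj : j = i
    · subst hj
      rw [hVi]
      split_ifs <;> simp [hqd, hqx]
    · rw [hVj j l hj]
      split_ifs <;> simp [hq.mul_self]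
  · intro j l
    by_cases hj : j = i
    · subst hj
      rw [hVi]
      split_ifs
      exacts [hq.mul_sum hdq, hq.mul_sum hxq, zero_mul _]
    · rw [hVj j l hj]
      split_ifs
      exacts [hq.mul_sum (hq.mul_self j), zero_mul _]
  · intro j
    by_cases hj : j = i
    · subst hj
      rw [← Finset.add_sum_erase _ _ (Finset.mem_univ j),
        ← Finset.add_sum_erase _ _ (Finset.mem_erase.2 ⟨hik.symm, Finset.mem_univ k⟩),
        Finset.sum_eq_zero]
      · rw [hVi, hVi, if_pos rfl, if_neg hik.symm, if_pos rfl, hds, hdd]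
        abel
      · intro l hl
        simp only [Finset.mem_erase, Finset.mem_univ, and_true] at hl
        rw [hVi, if_neg hl.2, if_neg hl.1, zero_mul]
    · rw [Finset.sum_eq_single j]
      · rw [hVj j j hj, if_pos rfl, hq.star_eq, hq.mul_self]
      · intro l _ hl
        rw [hVj j l hj, if_neg hl.symm, zero_mul]
      · simp
  · intro _ a ha c l hc hl
    -- As `k ≠ i`, row `k` of an element of the algebra is diagonal. Hence only column `k` of `V` is
    -- tested, where the condition reads `x = x * q k`; the entry `d` in column `i` is never
    -- compared.
    have hck : c = k := by
      by_contra h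
      refine hc (ha k c (Ne.symm h) ?_)
      intro h'
      exact hik (congrArg Prod.fst h').symm
    subst hck
    rw [hVj c l hik.symm] at hl ⊢
    have hlc : c = l := by
      by_contra h
      exact hl (if_neg h)
    subst hlc
    rw [hVi, if_neg hik.symm, if_pos rfl, if_pos rfl, hxq]

/-! ### Upper triangular matrices -/

theorem single_mem_upperTri {n : ℕ} {j c : Fin n} (h : j ≤ c) :
    Matrix.single j c (1 : ℂ) ∈ upperTri n :=
  cornerAlg_le_upperTri h (single_mem_cornerAlg j c 1)

theorem upperTri_le_adjoin (n : ℕ) :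
    upperTri n ≤ Algebra.adjoin ℂ (Set.range (Sum.elim
      (fun j : Fin n => Matrix.single j j (1 : ℂ)) fun k : Fin (n - 1) =>
        Matrix.single ⟨k, by omega⟩ ⟨k + 1, by omega⟩ 1)) := by
  set S := Algebra.adjoin ℂ (Set.range (Sum.elim
      (fun j : Fin n => Matrix.single j j (1 : ℂ)) fun k : Fin (n - 1) =>
        Matrix.single ⟨k, by omega⟩ ⟨k + 1, by omega⟩ 1)) with hS
  -- Induction on the distance from the diagonal, through `E_{j,c} = E_{j,j+1} E_{j+1,c}`.
  have key : ∀ (m : ℕ) (j c : Fin n), (c : ℕ) = j + m → Matrix.single j c (1 : ℂ) ∈ S := by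
    intro m
    induction m with
    | zero =>
      intro j c h
      obtain rfl : c = j := Fin.ext h
      exact Algebra.subset_adjoin ⟨Sum.inl c, rfl⟩
    | succ m ih =>
      intro j c h
      have h1 := ih ⟨j + 1, by omega⟩ c (by simp only; omega)
      have h2 : Matrix.single j ⟨j + 1, by omega⟩ (1 : ℂ) ∈ S :=
        Algebra.subset_adjoin ⟨Sum.inr ⟨j, by omega⟩, rfl⟩
      have := S.mul_mem h2 h1
      rwa [Matrix.single_mul_single_same, one_mul] at this
  refine le_of_single_mem fun a ha j c hjc => ?_
  have hle : j ≤ c := by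
    by_contra h
    exact hjc (ha j c (not_le.1 h))
  exact key (c - j) j c (by have : (j : ℕ) ≤ c := hle; omega)

theorem cyc_eq {n : ℕ} {j c : Fin n} (h : (c : ℕ) = j + 1) : cyc j = c :=
  Fin.ext ((Nat.mod_eq_of_lt (by omega)).trans h.symm)

theorem sum_range_ite_le {X : Type*} [AddCommMonoid X] {n j : ℕ} (h : j ≤ n) (F : ℕ → X) :
    ∑ l ∈ Finset.range n, (if j ≤ l then F (l - j) else 0) = ∑ m ∈ Finset.range (n - j), F m := by
  obtain ⟨m, rfl⟩ := Nat.exists_eq_add_of_le h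
  rw [Finset.sum_range_add, Finset.sum_eq_zero, zero_add, Nat.add_sub_cancel_left]
  · exact Finset.sum_congr rfl fun l _ => by simp
  · intro l hl
    rw [if_neg (by have := Finset.mem_range.1 hl; omega)]

theorem sum_univ_ite_le {X : Type*} [AddCommMonoid X] {n : ℕ} (j : Fin n) (F : ℕ → X) :
    ∑ l : Fin n, (if j ≤ l then F (l - j) else 0) = ∑ m ∈ Finset.range (n - j), F m :=
  (Fin.sum_univ_eq_sum_range (fun l : ℕ => if (j : ℕ) ≤ l then F (l - j) else 0) n).trans
    (sum_range_ite_le j.2.le F)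

/-- Under this length condition the chain from `j` ends exactly at the last index, before `cyc` can
wrap around. Applied with `d = x`, it kills the telescoping remainder. -/
theorem chainProd_cyc_eq_zero {X : Type*} [NonUnitalNonAssocSemiring X] {n : ℕ} {x d : Fin n → X}
    (hd : ∀ j : Fin n, (j : ℕ) + 1 = n → d j = 0) (m : ℕ) (j : Fin n) (h : (j : ℕ) + m + 1 = n) :
    chainProd cyc x d m j = 0 := by
  induction m generalizing j with
  | zero => exact hd j (by omega)
  | succ m ih =>
    rw [chainProd, cyc_eq (c := ⟨j + 1, by omega⟩) rfl, ih _ (by simp only; omega), mul_zero]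

/-- A representation of `upperTri n` from projections and contractions. -/
theorem exists_isCCRep_upperTri {n : ℕ} {X : Type u} [NonUnitalCStarAlgebra X] {q : Fin n → X}
    (hq : IsProjFamily q) {x : Fin (n - 1) → X}
    (hqx : ∀ k : Fin (n - 1), q ⟨k, by omega⟩ * x k = x k)
    (hxq : ∀ k : Fin (n - 1), x k * q ⟨k + 1, by omega⟩ = x k) (hx : ∀ k, ‖x k‖ ≤ 1)
    (hn : n ≠ 0) :
    ∃ ρ : upperTri n → X, IsCCRep (upperTri n) ρ ∧
      (∀ j, ρ ⟨Matrix.single j j 1, single_mem_upperTri le_rfl⟩ = q j) ∧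
      ∀ k : Fin (n - 1), ρ ⟨Matrix.single ⟨k, by omega⟩ ⟨k + 1, by omega⟩ 1,
        single_mem_upperTri (Nat.le_succ _)⟩ = x k := by
  have : Nonempty (Fin n) := ⟨⟨0, Nat.pos_of_ne_zero hn⟩⟩
  -- The contractions are extended by zero at the last index. The wrap-around of `cyc` thus becomes
  -- harmless, and the cyclic chain products can be used.
  let y : Fin n → X := fun j => if h : (j : ℕ) < n - 1 then x ⟨j, h⟩ else 0
  have hylast : ∀ j : Fin n, (j : ℕ) + 1 = n → y j = 0 := fun j hj => dif_neg (by omega)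
  have hqy : ∀ j, q j * y j = y j := by
    intro j
    by_cases h : (j : ℕ) < n - 1
    · simpa [y, h] using hqx ⟨j, h⟩
    · simp [y, h]
  have hyq : ∀ j, y j * q (cyc j) = y j := by
    intro j
    by_cases h : (j : ℕ) < n - 1
    · have := hxq ⟨j, h⟩
      rw [cyc_eq (c := ⟨j + 1, by omega⟩) rfl]
      simpa [y, h] using this
    · simp [y, h]
  have hy : ∀ j, ‖y j‖ ≤ 1 := by
    intro j
    by_cases h : (j : ℕ) < n - 1
    · simpa [y, h] using hx ⟨j, h⟩
    · simp [y, h]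
  choose d hds hdd hqd _ using fun j =>
    exists_defect (hq.star_eq j) (hq.mul_self j) (hqy j) (hy j)
  have hdq : ∀ j, d j * q j = d j := by
    intro j
    apply star_injective
    rw [star_mul, hds, hq.star_eq, hqd]
  -- The entry at `(j, l)` is the chain along the only path from `j` to `l` in the linear graph,
  -- closed by the defect at `l`.
  let V : Fin n → Fin n → X := fun j l => if j ≤ l then chainProd cyc y d (l - j) j else 0
  refine exists_isCCRep_of_rows (A := upperTri n) (κ := Fin (n - 1))
    (s := fun k => ⟨k, by omega⟩) (t := fun k => ⟨k + 1, by omega⟩)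
    (fun j => single_mem_upperTri le_rfl)
    (fun k => single_mem_upperTri (Nat.le_succ _)) (upperTri_le_adjoin n) hq hxq
    (V := V) ?_ ?_ ?_ ?_
  · intro j l
    simp only [V]
    split_ifs
    exacts [mul_chainProd hqy hqd _ _, mul_zero _]
  · intro j l
    simp only [V]
    split_ifs
    exacts [chainProd_mul (fun b => hq.mul_sum (hdq b)) _ _, zero_mul _]
  · intro j
    have h1 : ∀ l, V j l * star (V j l) = if j ≤ l then (fun m : ℕ =>
        chainProd cyc y d m j * star (chainProd cyc y d m j)) (l - j) else 0 := by
      intro l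
      simp only [V]
      split_ifs <;> simp
    -- Reindexed by path length, the row sum telescopes up to length `n - 1 - j`, where the
    -- remainder contains `y` at the last index and is zero.
    rw [Finset.sum_congr rfl fun l _ => h1 l,
      sum_univ_ite_le j fun m : ℕ => chainProd cyc y d m j * star (chainProd cyc y d m j),
      show n - (j : ℕ) = (n - 1 - j) + 1 by omega,
      sum_chainProd_mul_star hyq (fun b => by rw [hds, hdd]),
      chainProd_cyc_eq_zero hylast _ _ (by omega), zero_mul, sub_zero]
  · intro k a ha c l hc hl
    have hkc : (k : ℕ) + 1 ≤ c := by
      by_contra h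
      exact hc (ha _ c (Fin.lt_def.2 (by simpa using h)))
    have hcl : (c : ℕ) ≤ l := by
      by_contra h
      exact hl (if_neg (fun h' => h h'))
    -- Triangularity of `a` and of `V` gives `k + 1 ≤ c ≤ l`, so the recursion of the chain applies.
    -- The column `l = k`, where row `k` holds a defect but row `k + 1` is zero, is excluded.
    have e1 : (l : ℕ) - k = (l - (k + 1)) + 1 := by omega
    have hk : (k : ℕ) < n - 1 := k.2
    simp only [V]
    rw [if_pos (Fin.le_def.2 (by simp only; omega)), if_pos (Fin.le_def.2 (by simp only; omega)),
      e1, chainProd, cyc_eq (n := n) (j := ⟨k, by omega⟩) (c := ⟨k + 1, by omega⟩) rfl]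
    simp [y]

/-! ### Compressions of operators on a Hilbert space -/

section Compression

attribute [local instance] InnerProductSpace.toInner

variable {H : Type u} [NormedAddCommGroup H] [InnerProductSpace ℂ H] [CompleteSpace H]
  {J : Type v} [Fintype J] [DecidableEq J]

open InnerProductSpace ContinuousLinearMap

/-- The operators on the span of an orthonormal family with a given matrix. -/
noncomputable def matrixOpHom {e : J → H} (he : Orthonormal ℂ e) :
    Matrix J J ℂ →⋆ₙₐ[ℂ] (H →L[ℂ] H) where
  toFun b := ∑ j, ∑ k, b j k • rankOne ℂ (e j) (e k)
  map_smul' c b := by simp [Finset.smul_sum, mul_smul]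
  map_zero' := by simp
  map_add' b c := by simp [add_smul, Finset.sum_add_distrib]
  map_mul' b c := by
    have h : ∀ j k l m, rankOne ℂ (e j) (e k) * rankOne ℂ (e l) (e m) =
        if k = l then rankOne ℂ (e j) (e m) else 0 := by
      intro j k l m
      rw [mul_def, rankOne_comp_rankOne, orthonormal_iff_ite.1 he]
      split_ifs <;> simp
    simp only [Finset.sum_mul, Finset.mul_sum, smul_mul_smul_comm, h, Matrix.mul_apply,
      Finset.sum_smul, smul_ite, smul_zero]
    conv_lhs => rw [Finset.sum_comm]
    conv_rhs => rw [Finset.sum_comm]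
    refine Finset.sum_congr rfl fun k _ => (Finset.sum_comm.trans ?_)
    simp
  map_star' b := by
    simp only [star_sum, star_smul, star_eq_adjoint, adjoint_rankOne, Matrix.star_apply]
    exact Finset.sum_comm

theorem matrixOpHom_apply {e : J → H} (he : Orthonormal ℂ e) (b : Matrix J J ℂ) :
    matrixOpHom he b = ∑ j, ∑ k, b j k • rankOne ℂ (e j) (e k) := rfl

theorem inner_matrixOpHom {e : J → H} (he : Orthonormal ℂ e) (b : Matrix J J ℂ) (j k : J) :
    inner ℂ (e j) (matrixOpHom he b (e k)) = b j k := by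
  simp [matrixOpHom_apply,
    orthonormal_iff_ite.1 he]

/-- The matrix of the compression of `a` to the span of an orthonormal family. -/
noncomputable def compressionMatrix (e : J → H) (a : H →L[ℂ] H) : Matrix J J ℂ :=
  Matrix.of fun j k => inner ℂ (e j) (a (e k))

/-- Realized faithfully on the span of the orthonormal family, the matrix of the compression is `P *
a * P`, where `P` is the projection onto the span, the image of the identity matrix. -/
theorem matLE_compressionMatrix {e : J → H} (he : Orthonormal ℂ e) :
    MatLE (compressionMatrix e) fun a : H →L[ℂ] H => a := by
  have hinj : Function.Injective (matrixOpHom he) := by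
    intro b c hbc
    ext j k
    rw [← inner_matrixOpHom he b j k, hbc, inner_matrixOpHom]
  have hc : ‖matrixOpHom he 1‖ ≤ 1 :=
    norm_le_one_of_projection (by rw [← map_star, star_one]) (by rw [← map_mul, one_mul])
  have h1 : matrixOpHom he 1 = ∑ j, rankOne ℂ (e j) (e j) := by
    simp [matrixOpHom_apply, Matrix.one_apply]
  have key (φ : Matrix J J ℂ →⋆ₙₐ[ℂ] (H →L[ℂ] H)) (hφ : Function.Injective φ)
      (hφ1 : ‖φ 1‖ ≤ 1) (h : ∀ a, φ (compressionMatrix e a) = φ 1 * a * star (φ 1)) :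
      MatLE (compressionMatrix e) fun a : H →L[ℂ] H => a :=
    MatLE.of_conj φ hφ hφ1 h
  refine key (matrixOpHom he) hinj hc fun a => ?_
  rw [← map_star, star_one, h1, matrixOpHom_apply]
  simp only [Finset.sum_mul, Finset.mul_sum, compressionMatrix, Matrix.of_apply]
  rw [Finset.sum_comm]
  refine Finset.sum_congr rfl fun k _ => Finset.sum_congr rfl fun j _ => ?_
  rw [mul_assoc, mul_def a, comp_rankOne, mul_def, rankOne_comp_rankOne]

end Compression

/-! ### Partial isometries between coordinates -/

section Shift

attribute [local instance] InnerProductSpace.toInner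

open ContinuousLinearMap

/-- The unit vector `ξ_s`. -/
noncomputable def unitVec {S : Type u} (s : S) : lp (fun _ : S => ℂ) 2 := by
  classical exact lp.single 2 s 1

theorem inner_unitVec {S : Type u} (s : S) (v : lp (fun _ : S => ℂ) 2) :
    inner ℂ (unitVec s) v = v s := by
  classical
  simp [unitVec, lp.inner_single_left]

theorem unitVec_apply {S : Type u} [DecidableEq S] (s t : S) :
    (unitVec s : S → ℂ) t = if t = s then 1 else 0 := by
  by_cases h : t = s
  · subst h
    simp [unitVec]
  · simp [unitVec, h]

theorem orthonormal_unitVec (S : Type u) : Orthonormal ℂ (unitVec (S := S)) := by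
  classical
  refine orthonormal_iff_ite.2 fun s t => ?_
  rw [inner_unitVec, unitVec_apply]

theorem ell2Map_unitVec {K S : Type u} {f : K → S} (hf : Function.Injective f) (k : K) :
    ell2Map f hf (unitVec k) = unitVec (f k) := by
  classical
  unfold ell2Map unitVec
  refine (OrthogonalFamily.linearIsometry_apply_single _ _).trans ?_
  simp
  rfl

theorem adjoint_ell2Map_unitVec {K S : Type u} {f : K → S} (hf : Function.Injective f) (k : K) :
    adjoint (ell2Map f hf).toContinuousLinearMap (unitVec (f k)) = unitVec k := by
  refine lp.ext (funext fun i => ?_)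
  rw [← inner_unitVec, adjoint_inner_right, ← inner_unitVec]
  change inner ℂ (ell2Map f hf (unitVec i)) _ = _
  rw [← ell2Map_unitVec hf, LinearIsometry.inner_map_map]

theorem adjoint_ell2Map_unitVec_of_notMem {K S : Type u} {f : K → S} (hf : Function.Injective f)
    {s : S} (hs : s ∉ Set.range f) :
    adjoint (ell2Map f hf).toContinuousLinearMap (unitVec s) = 0 := by
  classical
  refine lp.ext (funext fun i => ?_)
  rw [← inner_unitVec, adjoint_inner_right]
  change inner ℂ (ell2Map f hf (unitVec i)) _ = _
  rw [ell2Map_unitVec hf, inner_unitVec, unitVec_apply, if_neg (fun h => hs ⟨i, h⟩)]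
  rfl

theorem adjoint_ell2Shift {K S : Type u} {f g : K → S} (hf : Function.Injective f)
    (hg : Function.Injective g) : adjoint (ell2Shift f g hf hg) = ell2Shift g f hg hf := by
  rw [ell2Shift, adjoint_comp, adjoint_adjoint, ell2Shift]

theorem ell2Shift_unitVec {K S : Type u} {f g : K → S} (hf : Function.Injective f)
    (hg : Function.Injective g) (k : K) : ell2Shift f g hf hg (unitVec (g k)) = unitVec (f k) := by
  rw [ell2Shift, comp_apply, adjoint_ell2Map_unitVec]
  exact ell2Map_unitVec hf k

theorem ell2Shift_unitVec_of_notMem {K S : Type u} {f g : K → S} (hf : Function.Injective f)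
    (hg : Function.Injective g) {s : S} (hs : s ∉ Set.range g) :
    ell2Shift f g hf hg (unitVec s) = 0 := by
  rw [ell2Shift, comp_apply, adjoint_ell2Map_unitVec_of_notMem hg hs, map_zero]

end Shift

/-! ### Generators on the Fock space -/

section Fock

open ContinuousLinearMap

variable {V : Type u} [Quiver.{u} V]

theorem star_vertexProj (a : V) : star (vertexProj a) = vertexProj a :=
  adjoint_ell2Shift _ _

theorem vertexProj_unitVec (a : V) (w : PathSpace V) [Decidable (w.1 = a)] :
    vertexProj a (unitVec w) = if w.1 = a then unitVec w else 0 := by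
  split_ifs with h
  · obtain ⟨b, w⟩ := w
    obtain rfl : b = a := h
    exact ell2Shift_unitVec _ _ w
  · refine ell2Shift_unitVec_of_notMem _ _ ?_
    rintro ⟨w', rfl⟩
    exact h rfl

theorem star_creation_prependEdge {a b : V} (e : a ⟶ b) (w : Σ c : V, Quiver.Path b c) :
    star (creation e) (unitVec (prependEdge e w)) = unitVec (pathsFrom b w) := by
  rw [star_eq_adjoint, creation, adjoint_ell2Shift]
  exact ell2Shift_unitVec _ _ w

theorem star_creation_of_notMem {a b : V} (e : a ⟶ b) {w : PathSpace V}
    (hw : w ∉ Set.range (prependEdge e)) : star (creation e) (unitVec w) = 0 := by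
  rw [star_eq_adjoint, creation, adjoint_ell2Shift]
  exact ell2Shift_unitVec_of_notMem _ _ hw

end Fock

/-! ### Paths of the cycle -/

/-- The path of length `k` in the cycle that starts at `b`. -/
def cyclePathFrom {n : ℕ} : ℕ → (b : CycleGraph n) → Σ c : CycleGraph n, Quiver.Path b c
  | 0, b => ⟨b, Quiver.Path.nil⟩
  | k + 1, b => ⟨(cyclePathFrom k (cyc (n := n) b)).1,
      (Quiver.Hom.toPath (cycleEdge (n := n) b)).comp (cyclePathFrom k (cyc (n := n) b)).2⟩

/-- The path of length `k` that starts at `b`, as an element of the path space. -/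
def cyclePath {n : ℕ} (b : Fin n) (k : ℕ) : PathSpace (CycleGraph n) :=
  pathsFrom (V := CycleGraph n) b (cyclePathFrom k b)

theorem length_cyclePathFrom {n : ℕ} (k : ℕ) (b : CycleGraph n) :
    (cyclePathFrom k b).2.length = k := by
  induction k generalizing b with
  | zero => rfl
  | succ k ih =>
    refine (Quiver.Path.length_comp _ _).trans ?_
    exact (congrArg₂ (· + ·) (Quiver.Path.length_toPath _) (ih _)).trans (add_comm _ _)

/-- A path of the cycle is recovered from its first vertex and its length. It is not needed that
these are all the paths: adjoints of the generators map each of their unit vectors to another one or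
to zero, and that is all the argument uses. -/
theorem cyclePath_injective {n : ℕ} :
    Function.Injective fun w : Fin n × ℕ => cyclePath w.1 w.2 := by
  rintro ⟨b, k⟩ ⟨c, m⟩ h
  have h1 : b = c := congrArg Sigma.fst h
  have h2 := congrArg (fun w : PathSpace (CycleGraph n) => w.2.2.length) h
  have h3 : k = m := (length_cyclePathFrom k b).symm.trans (h2.trans (length_cyclePathFrom m c))
  rw [h1, h3]

section CycleGenerators

open ContinuousLinearMap

variable {n : ℕ}

/-- The projection onto the span of the paths that start at the vertex `c` of the cycle. -/
noncomputable def cycleProj (c : Fin n) :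
    FockSpace (CycleGraph n) →L[ℂ] FockSpace (CycleGraph n) :=
  vertexProj (V := CycleGraph n) c

/-- The creation operator of the edge of the cycle that starts at `c`. -/
noncomputable def cycleCreation (c : Fin n) :
    FockSpace (CycleGraph n) →L[ℂ] FockSpace (CycleGraph n) :=
  creation (cycleEdge c)

theorem star_cycleProj_cyclePath (c b : Fin n) (k : ℕ) :
    star (cycleProj c) (unitVec (cyclePath b k)) =
      if b = c then unitVec (cyclePath b k) else 0 := by
  have h : star (cycleProj c) = cycleProj c := star_vertexProj (V := CycleGraph n) c
  rw [h]
  exact @vertexProj_unitVec (CycleGraph n) _ c (cyclePath b k) (inferInstanceAs (Decidable (b = c)))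

theorem star_cycleCreation_cyclePath_zero (c b : Fin n) :
    star (cycleCreation c) (unitVec (cyclePath b 0)) = 0 := by
  refine star_creation_of_notMem _ ?_
  rintro ⟨w, hw⟩
  have h2 := congrArg (fun w : PathSpace (CycleGraph n) => w.2.2.length) hw
  have h3 : ((cycleEdge c).toPath.comp w.2).length = 0 := h2
  have h4 := (Quiver.Path.length_comp (cycleEdge c).toPath w.2).symm.trans h3
  exact one_ne_zero ((Quiver.Path.length_toPath (cycleEdge c)).symm.trans (Nat.add_eq_zero_iff.1 h4).1)

theorem star_cycleCreation_cyclePath_succ (c b : Fin n) (k : ℕ) :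
    star (cycleCreation c) (unitVec (cyclePath b (k + 1))) =
      if b = c then unitVec (cyclePath (cyc c) k) else 0 := by
  split_ifs with h
  · subst h
    exact star_creation_prependEdge (cycleEdge b) (cyclePathFrom k (cyc b))
  · refine star_creation_of_notMem _ ?_
    rintro ⟨w, hw⟩
    exact h (congrArg Sigma.fst hw).symm

end CycleGenerators

/-! ### The approximating maps on the operators on the Fock space of the cycle -/

section CycleMap

attribute [local instance] InnerProductSpace.toInner

open ContinuousLinearMap

variable {n : ℕ} {X : Type v} [NonUnitalCStarAlgebra X]

/-- The matrix coefficients of operators with respect to the paths. -/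
noncomputable def pathCoeff (a : FockSpace (CycleGraph n) →L[ℂ] FockSpace (CycleGraph n))
    (b : Fin n) (k : ℕ) (c : Fin n) (m : ℕ) : ℂ :=
  inner ℂ (unitVec (cyclePath b k)) (a (unitVec (cyclePath c m)))

/-- Left multiplication acts on the row index alone, through the adjoint; the adjoint of a creation
operator removes the first edge of a path. -/
theorem pathCoeff_mul (g a : FockSpace (CycleGraph n) →L[ℂ] FockSpace (CycleGraph n))
    (b : Fin n) (k : ℕ) (c : Fin n) (m : ℕ) :
    pathCoeff (g * a) b k c m =
      inner ℂ (star g (unitVec (cyclePath b k))) (a (unitVec (cyclePath c m))) := by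
  rw [star_eq_adjoint, adjoint_inner_left]
  rfl

theorem norm_pathCoeff_le (a : FockSpace (CycleGraph n) →L[ℂ] FockSpace (CycleGraph n))
    (b : Fin n) (k : ℕ) (c : Fin n) (m : ℕ) : ‖pathCoeff a b k c m‖ ≤ ‖a‖ := by
  have h : ∀ w : PathSpace (CycleGraph n), ‖unitVec w‖ = 1 := (orthonormal_unitVec _).1
  calc ‖pathCoeff a b k c m‖ ≤ ‖unitVec (cyclePath b k)‖ * ‖a (unitVec (cyclePath c m))‖ :=
        norm_inner_le_norm _ _
    _ ≤ 1 * (‖a‖ * 1) := by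
        rw [h]
        gcongr
        exact (a.le_opNorm _).trans_eq (by rw [h])
    _ = ‖a‖ := by ring

/-- The row with index the path of length `k` from `b` of the matrix of `a`, applied to the column
of the adjoints of the `W c m`, with `m ≤ N`. -/
noncomputable def rowSum (W : ℕ → Fin n → X) (N : ℕ) (b : Fin n) (k : ℕ) :
    (FockSpace (CycleGraph n) →L[ℂ] FockSpace (CycleGraph n)) →ₗ[ℂ] X where
  toFun a := ∑ c, ∑ m ∈ Finset.range (N + 1), pathCoeff a b k c m • star (W m c)
  map_add' x y := by
    simp [pathCoeff, add_smul, Finset.sum_add_distrib]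
  map_smul' t x := by
    simp [pathCoeff, mul_smul, Finset.smul_sum]

/-- The map `a ↦ W (a ⊗ 1) W*`, for the compression of operators to the paths of length at most `N`
and a row `W` indexed by these paths. -/
noncomputable def fockMap (W : ℕ → Fin n → X) (N : ℕ) :
    (FockSpace (CycleGraph n) →L[ℂ] FockSpace (CycleGraph n)) →ₗ[ℂ] X where
  toFun a := ∑ b, ∑ k ∈ Finset.range (N + 1), W k b * rowSum W N b k a
  map_add' x y := by simp [mul_add, Finset.sum_add_distrib]
  map_smul' t x := by simp [mul_smul_comm, Finset.smul_sum]

theorem fockMap_apply (W : ℕ → Fin n → X) (N : ℕ)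
    (a : FockSpace (CycleGraph n) →L[ℂ] FockSpace (CycleGraph n)) :
    fockMap W N a = ∑ b, ∑ k ∈ Finset.range (N + 1), W k b * rowSum W N b k a := rfl

theorem rowSum_apply (W : ℕ → Fin n → X) (N : ℕ) (b : Fin n) (k : ℕ)
    (a : FockSpace (CycleGraph n) →L[ℂ] FockSpace (CycleGraph n)) :
    rowSum W N b k a = ∑ c, ∑ m ∈ Finset.range (N + 1), pathCoeff a b k c m • star (W m c) := rfl

/-- A crude bound, linear in `N`; it is multiplied later by a chain of length `N`, which decays
geometrically. -/
theorem norm_rowSum_le {W : ℕ → Fin n → X} {C : ℝ} (hW : ∀ k b, ‖W k b‖ ≤ C) (N : ℕ) (b : Fin n)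
    (k : ℕ) (a : FockSpace (CycleGraph n) →L[ℂ] FockSpace (CycleGraph n)) :
    ‖rowSum W N b k a‖ ≤ n * ((N + 1) * (‖a‖ * C)) := by
  rw [rowSum_apply]
  calc _ ≤ ∑ _c : Fin n, ∑ _m ∈ Finset.range (N + 1), ‖a‖ * C := by
        refine norm_sum_le_of_le _ fun c _ => norm_sum_le_of_le _ fun m _ => ?_
        rw [norm_smul, norm_star]
        gcongr
        exacts [norm_pathCoeff_le _ _ _ _ _, hW _ _]
    _ = _ := by simp

theorem rowSum_cycleProj_mul (W : ℕ → Fin n → X) (N : ℕ) (c b : Fin n) (k : ℕ)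
    (a : FockSpace (CycleGraph n) →L[ℂ] FockSpace (CycleGraph n)) :
    rowSum W N b k (cycleProj c * a) =
      if b = c then rowSum W N b k a else 0 := by
  simp only [rowSum_apply, pathCoeff_mul, star_cycleProj_cyclePath]
  split_ifs
  · rfl
  · simp

theorem rowSum_cycleCreation_mul_zero (W : ℕ → Fin n → X) (N : ℕ) (c b : Fin n)
    (a : FockSpace (CycleGraph n) →L[ℂ] FockSpace (CycleGraph n)) :
    rowSum W N b 0 (cycleCreation c * a) = 0 := by
  simp [rowSum_apply, pathCoeff_mul, star_cycleCreation_cyclePath_zero]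

theorem rowSum_cycleCreation_mul_succ (W : ℕ → Fin n → X) (N : ℕ) (c b : Fin n) (k : ℕ)
    (a : FockSpace (CycleGraph n) →L[ℂ] FockSpace (CycleGraph n)) :
    rowSum W N b (k + 1) (cycleCreation c * a) =
      if b = c then rowSum W N (cyc c) k a else 0 := by
  simp only [rowSum_apply, pathCoeff_mul, star_cycleCreation_cyclePath_succ]
  split_ifs
  · rfl
  · simp

theorem rowSum_one (W : ℕ → Fin n → X) (N : ℕ) (b : Fin n) {k : ℕ} (hk : k ≤ N) :
    rowSum W N b k 1 = star (W k b) := by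
  have h : ∀ c m, pathCoeff (1 : FockSpace (CycleGraph n) →L[ℂ] FockSpace (CycleGraph n)) b k c m =
      if (b, k) = (c, m) then 1 else 0 := by
    intro c m
    exact orthonormal_iff_ite.1 ((orthonormal_unitVec _).comp _ cyclePath_injective) (b, k) (c, m)
  simp only [rowSum_apply, h]
  rw [Finset.sum_eq_single b, Finset.sum_eq_single k]
  · simp
  · intro m _ hm
    simp [hm.symm]
  · intro hk'
    exact absurd (Finset.mem_range.2 (Nat.lt_succ_of_le hk)) hk'
  · intro c _ hc
    refine Finset.sum_eq_zero fun m _ => ?_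
    simp [hc.symm]
  · simp

/-- The map is the compression to the finitely many paths of length at most `N`, followed by
conjugation of scalar matrices with the row `W`. -/
theorem matLE_fockMap [NeZero n] {p : X} (hp : p * p = p) (hs : star p = p) {W : ℕ → Fin n → X}
    (hW : ∀ k b, W k b * p = W k b) {N : ℕ}
    (h1 : ‖∑ b, ∑ k ∈ Finset.range (N + 1), W k b * star (W k b)‖ ≤ 1) :
    MatLE (fockMap W N)
      fun a : FockSpace (CycleGraph n) →L[ℂ] FockSpace (CycleGraph n) => a := by
  let e : Fin n × Fin (N + 1) → FockSpace (CycleGraph n) := fun w => unitVec (cyclePath w.1 w.2)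
  have he : Orthonormal ℂ e := by
    refine (orthonormal_unitVec _).comp
      (fun w : Fin n × Fin (N + 1) => cyclePath w.1 (w.2 : ℕ)) ?_
    rintro ⟨b, k⟩ ⟨c, m⟩ h
    have := @cyclePath_injective n (b, (k : ℕ)) (c, (m : ℕ)) h
    simp only [Prod.mk.injEq] at this ⊢
    exact ⟨this.1, Fin.ext this.2⟩
  have h2 := (MatLE.sum_smul_mul_star (J := Fin n × Fin (N + 1)) hp hs
    (V := fun w => W w.2 w.1) (fun w => hW _ _) (by
      rw [Fintype.sum_prod_type]
      simpa only [Finset.sum_range] using h1)).comp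
    (compressionMatrix e)
  refine MatLE.trans ?_ (h2.trans (matLE_compressionMatrix he))
  refine fun k m => le_of_eq (congrArg (fun F : (FockSpace (CycleGraph n) →L[ℂ]
    FockSpace (CycleGraph n)) → X => matNorm (m.map F)) ?_)
  funext a
  simp only [fockMap_apply, rowSum_apply, Fintype.sum_prod_type, compressionMatrix,
    Matrix.of_apply, e, Finset.mul_sum, mul_smul_comm]
  simp only [Finset.sum_range]
  rfl

theorem fockMap_cycleProj_mul {q : Fin n → X} (hq : IsProjFamily q) {W : ℕ → Fin n → X}
    (hqW : ∀ k b, q b * W k b = W k b) (N : ℕ) (c : Fin n)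
    (a : FockSpace (CycleGraph n) →L[ℂ] FockSpace (CycleGraph n)) :
    fockMap W N (cycleProj c * a) = q c * fockMap W N a := by
  simp only [fockMap_apply, rowSum_cycleProj_mul, Finset.mul_sum]
  refine Finset.sum_congr rfl fun b _ => Finset.sum_congr rfl fun k _ => ?_
  rw [← mul_assoc]
  split_ifs with h
  · rw [← h, hqW]
  · rw [hq.mul_eq_zero (Ne.symm h) (hqW k b), mul_zero, zero_mul]

/-- The relation `W (k + 1) c = x c * W k (cyc c)` matches the terms one by one. The error is the
single term of length `N`: prepending an edge takes it to length `N + 1`, beyond the cutoff. -/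
theorem fockMap_cycleCreation_mul {q : Fin n → X} (hq : IsProjFamily q) {x d : Fin n → X}
    (hqx : ∀ b, q b * x b = x b) (hxq : ∀ b, x b * q (cyc b) = x b) (hqd : ∀ b, q b * d b = d b)
    (N : ℕ) (c : Fin n) (a : FockSpace (CycleGraph n) →L[ℂ] FockSpace (CycleGraph n)) :
    fockMap (chainProd cyc x d) N (cycleCreation c * a) =
      x c * fockMap (chainProd cyc x d) N a -
        x c * (chainProd cyc x d N (cyc c) * rowSum (chainProd cyc x d) N (cyc c) N a) := by
  have h1 : fockMap (chainProd cyc x d) N (cycleCreation c * a) =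
      ∑ k ∈ Finset.range N, x c * (chainProd cyc x d k (cyc c) *
        rowSum (chainProd cyc x d) N (cyc c) k a) := by
    rw [fockMap_apply, Finset.sum_eq_single c]
    · rw [Finset.sum_range_succ', rowSum_cycleCreation_mul_zero, mul_zero, add_zero]
      refine Finset.sum_congr rfl fun k _ => ?_
      rw [rowSum_cycleCreation_mul_succ, if_pos rfl, chainProd, mul_assoc]
    · intro b _ hb
      refine Finset.sum_eq_zero fun k _ => ?_
      cases k with
      | zero => rw [rowSum_cycleCreation_mul_zero, mul_zero]
      | succ k => rw [rowSum_cycleCreation_mul_succ, if_neg hb, mul_zero]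
    · simp
  have h2 : x c * fockMap (chainProd cyc x d) N a =
      ∑ k ∈ Finset.range (N + 1), x c * (chainProd cyc x d k (cyc c) *
        rowSum (chainProd cyc x d) N (cyc c) k a) := by
    rw [fockMap_apply, Finset.mul_sum, Finset.sum_eq_single (cyc c)]
    · rw [Finset.mul_sum]
    · intro b _ hb
      rw [Finset.mul_sum]
      refine Finset.sum_eq_zero fun k _ => ?_
      rw [← mul_assoc, ← hxq c, mul_assoc (x c),
        hq.mul_eq_zero hb.symm (mul_chainProd hqx hqd k b), mul_zero, zero_mul]
    · simp
  rw [h1, h2, Finset.sum_range_succ, add_sub_cancel_right]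

/-- By orthonormality only the diagonal terms `W k b * star (W k b)` remain, and their sum
telescopes. -/
theorem fockMap_one {q : Fin n → X} {x d : Fin n → X} (hxq : ∀ b, x b * q (cyc b) = x b)
    (hd : ∀ b, d b * star (d b) = q b - x b * star (x b)) (N : ℕ) :
    fockMap (chainProd cyc x d) N 1 =
      ∑ b, (q b - chainProd cyc x x N b * star (chainProd cyc x x N b)) := by
  rw [fockMap_apply]
  refine Finset.sum_congr rfl fun b _ => ?_
  rw [← sum_chainProd_mul_star hxq hd]
  refine Finset.sum_congr rfl fun k hk => ?_
  rw [rowSum_one _ _ _ (Nat.lt_succ_iff.1 (Finset.mem_range.1 hk))]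

end CycleMap

/-! ### Representations of the algebra of the cycle -/

/-- Telescoping bounds each inner sum by `q b`, and the sum of the `q b` is a projection. -/
theorem norm_sum_chainProd_le {X : Type u} [NonUnitalCStarAlgebra X] {B : Type*} [Fintype B]
    {s : B → B} {q x d : B → X} (hq : IsProjFamily q) (hxq : ∀ b, x b * q (s b) = x b)
    (hd : ∀ b, d b * star (d b) = q b - x b * star (x b)) (N : ℕ) :
    ‖∑ b, ∑ k ∈ Finset.range (N + 1), chainProd s x d k b * star (chainProd s x d k b)‖ ≤ 1 := by
  let _ := CStarAlgebra.spectralOrder X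
  have _ := CStarAlgebra.spectralOrderedRing X
  refine (CStarAlgebra.norm_le_norm_of_nonneg_of_le ?_ ?_).trans hq.norm_sum_le
  · exact Finset.sum_nonneg fun b _ => Finset.sum_nonneg fun k _ => mul_star_self_nonneg _
  · refine Finset.sum_le_sum fun b _ => ?_
    rw [sum_chainProd_mul_star hxq hd]
    exact sub_le_self _ (mul_star_self_nonneg _)

section Cycle

variable {n : ℕ}

theorem cycleProj_mem (c : Fin n) : cycleProj c ∈ graphAlg (CycleGraph n) :=
  vertexProj_mem (V := CycleGraph n) c

theorem cycleCreation_mem (c : Fin n) : cycleCreation c ∈ graphAlg (CycleGraph n) :=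
  creation_mem (cycleEdge c)

theorem graphAlg_subset_closure : (graphAlg (CycleGraph n) :
    Set (FockSpace (CycleGraph n) →L[ℂ] FockSpace (CycleGraph n))) ⊆
    closure ↑(Algebra.adjoin ℂ (Set.range (Sum.elim (cycleProj (n := n)) cycleCreation))) := by
  rw [graphAlg, Subalgebra.topologicalClosure_coe]
  refine closure_mono (Algebra.adjoin_mono ?_)
  rintro T (⟨a, rfl⟩ | ⟨a, b, e, rfl⟩)
  · exact ⟨Sum.inl a, rfl⟩
  · obtain ⟨rfl⟩ := e
    exact ⟨Sum.inr a, rfl⟩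

/-! ### Radii and cutoff lengths, and the limit for the cycle -/

/-- The radii `exp (-1 / (M + 1))`, for which paths of length greater than `(M + 1) ^ 2` are
negligible. -/
noncomputable def radius (M : ℕ) : ℝ := Real.exp (-(1 / ((M : ℝ) + 1)))

theorem radius_pos (M : ℕ) : 0 < radius M := Real.exp_pos _

theorem radius_le_one (M : ℕ) : radius M ≤ 1 :=
  Real.exp_le_one_iff.2 (neg_nonpos.2 (by positivity))

theorem radius_pow (M : ℕ) : radius M ^ ((M + 1) ^ 2) = Real.exp (-((M : ℝ) + 1)) := by
  rw [radius, ← Real.exp_nat_mul]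
  congr 1
  have : (M : ℝ) + 1 ≠ 0 := by positivity
  push_cast
  field_simp

open Filter Topology

theorem tendsto_radius : Tendsto radius atTop (𝓝 1) := by
  have h : Tendsto (fun M : ℕ => -(1 / ((M : ℝ) + 1))) atTop (𝓝 0) := by
    simpa using (tendsto_one_div_add_atTop_nhds_zero_nat (𝕜 := ℝ)).neg
  have h2 := (Real.continuous_exp.tendsto 0).comp h
  rwa [Real.exp_zero] at h2

theorem tendsto_radius_pow : Tendsto (fun M : ℕ => radius M ^ ((M + 1) ^ 2)) atTop (𝓝 0) := by
  simp only [radius_pow]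
  exact Real.tendsto_exp_neg_atTop_nhds_zero.comp
    (tendsto_atTop_add_const_right _ _ tendsto_natCast_atTop_atTop)

/-- With cutoff `N = (M + 1) ^ 2` the power of the radius is `exp (-(M + 1))`, which beats the
linear factor `N + 1` of the boundary term although the radii tend to `1`. -/
theorem tendsto_radius_pow_mul :
    Tendsto (fun M : ℕ => radius M ^ ((M + 1) ^ 2) * ((((M + 1) ^ 2 : ℕ) : ℝ) + 1)) atTop
      (𝓝 0) := by
  have h1 : Tendsto (fun M : ℕ => (M : ℝ) + 1) atTop atTop :=
    tendsto_atTop_add_const_right _ _ tendsto_natCast_atTop_atTop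
  have h2 := ((Real.tendsto_pow_mul_exp_neg_atTop_nhds_zero 2).comp h1).add
    (Real.tendsto_exp_neg_atTop_nhds_zero.comp h1)
  rw [add_zero] at h2
  refine h2.congr fun M => ?_
  rw [radius_pow]
  simp only [Function.comp_apply]
  push_cast
  ring

theorem exists_isCCRep_cycle [NeZero n] {X : Type v} [NonUnitalCStarAlgebra X] {q : Fin n → X}
    (hq : IsProjFamily q) {x : Fin n → X} (hqx : ∀ b, q b * x b = x b)
    (hxq : ∀ b, x b * q (cyc b) = x b) (hx : ∀ b, ‖x b‖ ≤ 1) :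
    ∃ ρ : graphAlg (CycleGraph n) → X, IsCCRep (graphAlg (CycleGraph n)) ρ ∧
      (∀ k, ρ ⟨cycleProj k, cycleProj_mem k⟩ = q k) ∧
      ∀ k, ρ ⟨cycleCreation k, cycleCreation_mem k⟩ = x k := by
  -- Shrinking is indispensable: if `x b * star (x b) = q b` for all `b`, the defects of the `x b`
  -- vanish and the unscaled map is zero.
  let y : ℕ → Fin n → X := fun M b => (radius M : ℂ) • x b
  have hqy : ∀ M b, q b * y M b = y M b := fun M b => by rw [mul_smul_comm, hqx]
  have hyq : ∀ M b, y M b * q (cyc b) = y M b := fun M b => by rw [smul_mul_assoc, hxq]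
  have hy : ∀ M b, ‖y M b‖ ≤ radius M := by
    intro M b
    rw [norm_smul, Complex.norm_real, Real.norm_of_nonneg (radius_pos M).le]
    exact mul_le_of_le_one_right (radius_pos M).le (hx b)
  have hy1 : ∀ M b, ‖y M b‖ ≤ 1 := fun M b => (hy M b).trans (radius_le_one M)
  choose d hds hdd hqd hd2 using fun (M : ℕ) (b : Fin n) =>
    exists_defect (hq.star_eq b) (hq.mul_self b) (hqy M b) (hy1 M b)
  have hdq : ∀ M b, d M b * (∑ c, q c) = d M b := by
    intro M b
    apply star_injective
    rw [star_mul, hds, hq.star_sum, hq.sum_mul (hqd M b)]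
  have hdd' : ∀ M b, d M b * star (d M b) = q b - y M b * star (y M b) := fun M b => by
    rw [hds, hdd]
  let N : ℕ → ℕ := fun M => (M + 1) ^ 2
  let f : ℕ → (FockSpace (CycleGraph n) →L[ℂ] FockSpace (CycleGraph n)) →ₗ[ℂ] X :=
    fun M => fockMap (chainProd cyc (y M) (d M)) (N M)
  have hf : ∀ M, MatLE (f M)
      fun a : FockSpace (CycleGraph n) →L[ℂ] FockSpace (CycleGraph n) => a := fun M =>
    matLE_fockMap hq.sum_mul_sum hq.star_sum (fun k b => chainProd_mul (hdq M) k b)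
      (norm_sum_chainProd_le hq (hyq M) (hdd' M) (N M))
  have hmem : ∀ k, Sum.elim (cycleProj (n := n)) cycleCreation k ∈ graphAlg (CycleGraph n) := by
    rintro (k | k)
    exacts [cycleProj_mem k, cycleCreation_mem k]
  suffices h : ∃ ρ : graphAlg (CycleGraph n) → X, IsCCRep (graphAlg (CycleGraph n)) ρ ∧
      ∀ k, ρ ⟨_, hmem k⟩ = Sum.elim q x k by
    obtain ⟨ρ, hρ, hρg⟩ := h
    exact ⟨ρ, hρ, fun j => hρg (Sum.inl j), fun k => hρg (Sum.inr k)⟩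
  refine exists_isCCRep_of_tendsto (l := atTop) (f := f) (q := ∑ j, q j) hmem
    graphAlg_subset_closure hf ?_ ?_ ?_ ?_
  · intro M a
    simp only [f, fockMap_apply, Finset.mul_sum]
    refine Finset.sum_congr rfl fun b _ => Finset.sum_congr rfl fun k _ => ?_
    rw [← mul_assoc, hq.sum_mul (mul_chainProd (hqy M) (hqd M) k b)]
  · simp only [f, fockMap_one (hyq _) (hdd' _)]
    refine tendsto_finsetSum _ fun b _ => ?_
    -- The telescoping remainder is a product of more than `N M` factors of norm at most the radius,
    -- so the values at `1` converge to the sum of the projections.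
    have h0 : Tendsto (fun M => chainProd cyc (y M) (y M) (N M) b) atTop (𝓝 0) :=
      squeeze_zero_norm (fun M => (norm_chainProd_le (hy M) (hy1 M) (N M) b).trans_eq (mul_one _))
        tendsto_radius_pow
    simpa using tendsto_const_nhds.sub (h0.mul h0.star)
  · rintro (k | k)
    exacts [hq.mul_sum (hq.mul_self k), hq.mul_sum (hxq k)]
  · rintro (c | c) a -
    · refine tendsto_const_nhds.congr fun M => (sub_eq_zero.2 ?_).symm
      exact fockMap_cycleProj_mul hq (mul_chainProd (hqy M) (hqd M)) (N M) c a
    · have hlim : Tendsto (fun M : ℕ => (1 - radius M) * ‖a‖ +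
          radius M ^ ((M + 1) ^ 2) * ((((M + 1) ^ 2 : ℕ) : ℝ) + 1) * (4 * n * ‖a‖)) atTop
          (𝓝 0) := by
        have h1 := (tendsto_const_nhds (x := (1 : ℝ)).sub tendsto_radius).mul_const ‖a‖
        have h2 := tendsto_radius_pow_mul.mul_const (4 * n * ‖a‖)
        simpa using h1.add h2
      refine squeeze_zero_norm (fun M => ?_) hlim
      simp only [Sum.elim_inr]
      -- Two errors: replacing `x c` by its multiple `y M c`, which costs at most `1 - radius M`
      -- times `‖a‖`, and the boundary term of length `N M`. The factor `4 * n` in the bound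
      -- collects the two estimates `‖d‖ ≤ 2` and the number of vertices.
      have hdec : f M (cycleCreation c * a) - x c * f M a = (y M c - x c) * f M a -
          y M c * (chainProd cyc (y M) (d M) (N M) (cyc c) *
            rowSum (chainProd cyc (y M) (d M)) (N M) (cyc c) (N M) a) := by
        simp only [f]
        rw [fockMap_cycleCreation_mul hq (hqy M) (hyq M) (hqd M), sub_mul]
        abel
      have hyx : ‖y M c - x c‖ ≤ 1 - radius M := by
        have : y M c - x c = ((radius M - 1 : ℝ) : ℂ) • x c := by
          simp [y, sub_smul]
        rw [this, norm_smul, Complex.norm_real, Real.norm_of_nonpos (by linarith [radius_le_one M])]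
        nlinarith [hx c, radius_le_one M]
      have hW : ∀ k b, ‖chainProd cyc (y M) (d M) k b‖ ≤ 2 := fun k b =>
        (norm_chainProd_le (hy1 M) (hd2 M) k b).trans_eq (by simp)
      rw [hdec]
      calc _ ≤ ‖y M c - x c‖ * ‖f M a‖ + ‖y M c‖ * (‖chainProd cyc (y M) (d M) (N M) (cyc c)‖ *
            ‖rowSum (chainProd cyc (y M) (d M)) (N M) (cyc c) (N M) a‖) := by
            refine (norm_sub_le _ _).trans (add_le_add (norm_mul_le _ _) ?_)
            refine (norm_mul_le _ _).trans ?_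
            gcongr
            exact norm_mul_le _ _
        _ ≤ (1 - radius M) * ‖a‖ + 1 * ((radius M ^ N M * 2) *
            (n * (((N M : ℕ) + 1) * (‖a‖ * 2)))) := by
            have hr := (radius_pos M).le
            have hr1 := radius_le_one M
            gcongr
            · exact (hf M).norm_le a
            · exact hy1 M c
            · exact norm_chainProd_le (hy M) (hd2 M) _ _
            · exact norm_rowSum_le hW _ _ _ _
        _ = _ := by
            simp only [N]
            ring

end Cycle

/-! ### Operator algebras generated by projections and contractions -/

namespace IsCCRep

variable {M : Type u} [CStarAlgebra M] {A : Subalgebra ℂ M} {X : Type v} {Y : Type w}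
  [NonUnitalCStarAlgebra X] [NonUnitalCStarAlgebra Y]

theorem comp_hom {f : A → X} (hf : IsCCRep A f) (φ : X →⋆ₙₐ[ℂ] Y) :
    IsCCRep A fun a => φ (f a) where
  map_add a b := by rw [hf.map_add, _root_.map_add]
  map_smul c a := by rw [hf.map_smul, _root_.map_smul]
  map_mul a b := by rw [hf.map_mul, _root_.map_mul]
  matNorm_le := MatLE.trans (h := fun a : A => (a : M)) (MatLE.map φ f) hf.matNorm_le

theorem restrict {B : Subalgebra ℂ M} (h : B ≤ A) {f : A → X} (hf : IsCCRep A f) :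
    IsCCRep B fun b => f ⟨b, h b.2⟩ where
  map_add a b := hf.map_add ⟨a, h a.2⟩ ⟨b, h b.2⟩
  map_smul c a := hf.map_smul c ⟨a, h a.2⟩
  map_mul a b := hf.map_mul ⟨a, h a.2⟩ ⟨b, h b.2⟩
  matNorm_le := MatLE.comp (g := fun a : A => (a : M)) hf.matNorm_le fun b : B => ⟨b, h b.2⟩

theorem map_zero {f : A → X} (hf : IsCCRep A f) : f 0 = 0 := by
  simpa using hf.map_smul 0 0

theorem map_sum {f : A → X} (hf : IsCCRep A f) {J : Type*} (S : Finset J) (a : J → A) :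
    f (∑ j ∈ S, a j) = ∑ j ∈ S, f (a j) := by
  classical
  induction S using Finset.induction_on with
  | empty => simpa using hf.map_zero
  | insert j S hj ih => rw [Finset.sum_insert hj, Finset.sum_insert hj, hf.map_add, ih]

theorem norm_sub_le {f : A → X} (hf : IsCCRep A f) (a b : A) :
    ‖f a - f b‖ ≤ ‖(a : M) - b‖ := by
  have h : f a - f b = f (a - b) := by
    rw [sub_eq_add_neg a, hf.map_add, ← neg_one_smul ℂ b, hf.map_smul, neg_one_smul,
      sub_eq_add_neg]
  rw [h]
  exact hf.norm_le _

end IsCCRep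

/-- The operator algebra `A` is generated by idempotent contractions `p k` with sum `1` and
contractions `l i` from the range of `p (t i)` to that of `p (s i)`. -/
structure HasGenerators {M : Type u} [CStarAlgebra M] (A : Subalgebra ℂ M) {n : ℕ} {I : Type v}
    (s t : I → Fin n) (p : Fin n → M) (l : I → M) : Prop where
  p_mem : ∀ k, p k ∈ A
  l_mem : ∀ i, l i ∈ A
  dense : (A : Set M) ⊆ closure ↑(Algebra.adjoin ℂ (Set.range (Sum.elim p l)))
  mul_self : ∀ k, p k * p k = p k
  mul_of_ne : ∀ k m, k ≠ m → p k * p m = 0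
  norm_p_le : ∀ k, ‖p k‖ ≤ 1
  sum_eq_one : ∑ k, p k = 1
  p_mul_l : ∀ i, p (s i) * l i = l i
  l_mul_p : ∀ i, l i * p (t i) = l i
  norm_l_le : ∀ i, ‖l i‖ ≤ 1

namespace HasGenerators

variable {M : Type u} [CStarAlgebra M] {A : Subalgebra ℂ M} {n : ℕ} {I : Type v}
  {s t : I → Fin n} {p : Fin n → M} {l : I → M} {X : Type w} [NonUnitalCStarAlgebra X]

/-- Here complete contractivity supplies adjoints: a contractive idempotent of a C*-algebra is a
projection. -/
theorem isProjFamily (h : HasGenerators A s t p l) {f : A → X} (hf : IsCCRep A f) :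
    IsProjFamily fun k => f ⟨p k, h.p_mem k⟩ := by
  have hmul : ∀ k, f ⟨p k, h.p_mem k⟩ * f ⟨p k, h.p_mem k⟩ = f ⟨p k, h.p_mem k⟩ := fun k =>
    (hf.map_mul _ _).symm.trans (congrArg f (Subtype.ext (h.mul_self k)))
  refine ⟨fun k => ?_, hmul, fun k m hkm => ?_⟩
  · exact star_eq_self_of_contractive_idempotent (hmul k) ((hf.norm_le _).trans (h.norm_p_le k))
  · exact (hf.map_mul _ _).symm.trans
      ((congrArg f (Subtype.ext (h.mul_of_ne k m hkm))).trans hf.map_zero)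

theorem apply_p_mul_l (h : HasGenerators A s t p l) {f : A → X} (hf : IsCCRep A f) (i : I) :
    f ⟨p (s i), h.p_mem _⟩ * f ⟨l i, h.l_mem i⟩ = f ⟨l i, h.l_mem i⟩ :=
  (hf.map_mul _ _).symm.trans (congrArg f (Subtype.ext (h.p_mul_l i)))

theorem apply_l_mul_p (h : HasGenerators A s t p l) {f : A → X} (hf : IsCCRep A f) (i : I) :
    f ⟨l i, h.l_mem i⟩ * f ⟨p (t i), h.p_mem _⟩ = f ⟨l i, h.l_mem i⟩ :=
  (hf.map_mul _ _).symm.trans (congrArg f (Subtype.ext (h.l_mul_p i)))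

theorem norm_apply_l_le (h : HasGenerators A s t p l) {f : A → X} (hf : IsCCRep A f) (i : I) :
    ‖f ⟨l i, h.l_mem i⟩‖ ≤ 1 :=
  (hf.norm_le _).trans (h.norm_l_le i)

/-- Completely contractive representations are determined by their values on the generators. -/
theorem ext (h : HasGenerators A s t p l) {f g : A → X} (hf : IsCCRep A f) (hg : IsCCRep A g)
    (hp : ∀ k, f ⟨p k, h.p_mem k⟩ = g ⟨p k, h.p_mem k⟩)
    (hl : ∀ i, f ⟨l i, h.l_mem i⟩ = g ⟨l i, h.l_mem i⟩) (a : A) : f a = g a := by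
  have hle : Algebra.adjoin ℂ (Set.range (Sum.elim p l)) ≤ A := by
    refine Algebra.adjoin_le ?_
    rintro _ ⟨k | i, rfl⟩
    exacts [h.p_mem k, h.l_mem i]
  -- The representations need not be unital, but `1` is the sum of the `p k`, so its image is
  -- determined as well.
  have hone : f 1 = g 1 := by
    have h1 : (1 : A) = ∑ k, ⟨p k, h.p_mem k⟩ := by
      apply Subtype.ext
      rw [AddSubmonoidClass.coe_finsetSum]
      exact h.sum_eq_one.symm
    rw [h1, hf.map_sum, hg.map_sum]
    exact Finset.sum_congr rfl fun k _ => hp k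
  have hadj : ∀ b (hb : b ∈ Algebra.adjoin ℂ (Set.range (Sum.elim p l))),
      f ⟨b, hle hb⟩ = g ⟨b, hle hb⟩ := by
    intro b hb
    induction hb using Algebra.adjoin_induction with
    | mem x hx =>
      obtain ⟨k | i, rfl⟩ := hx
      exacts [hp k, hl i]
    | algebraMap c =>
      have h1 : ∀ hc, (⟨algebraMap ℂ M c, hc⟩ : A) = c • 1 := fun hc =>
        Subtype.ext (Algebra.algebraMap_eq_smul_one c)
      rw [h1, hf.map_smul, hg.map_smul, hone]
    | add x y hx hy ihx ihy =>
      have h1 := hf.map_add ⟨x, hle hx⟩ ⟨y, hle hy⟩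
      have h2 := hg.map_add ⟨x, hle hx⟩ ⟨y, hle hy⟩
      rw [ihx, ihy] at h1
      exact h1.trans h2.symm
    | mul x y hx hy ihx ihy =>
      have h1 := hf.map_mul ⟨x, hle hx⟩ ⟨y, hle hy⟩
      have h2 := hg.map_mul ⟨x, hle hx⟩ ⟨y, hle hy⟩
      rw [ihx, ihy] at h1
      exact h1.trans h2.symm
  refine eq_of_forall_dist_le fun ε hε => ?_
  obtain ⟨b, hb, hab⟩ := Metric.mem_closure_iff.1 (h.dense a.2) (ε / 2) (half_pos hε)
  have hb' : b ∈ Algebra.adjoin ℂ (Set.range (Sum.elim p l)) := hb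
  have h1 := hf.norm_sub_le a ⟨b, hle hb'⟩
  have h2 := hg.norm_sub_le a ⟨b, hle hb'⟩
  rw [dist_eq_norm] at hab
  simp only at h1 h2
  rw [hadj b hb'] at h1
  calc dist (f a) (g a) ≤ dist (f a) (g ⟨b, hle hb'⟩) + dist (g a) (g ⟨b, hle hb'⟩) :=
        dist_triangle_right _ _ _
    _ ≤ ε / 2 + ε / 2 := by
        rw [dist_eq_norm, dist_eq_norm]
        gcongr <;> linarith
    _ = ε := add_halves ε

end HasGenerators

theorem norm_single_one_le {n : Type*} [Fintype n] [DecidableEq n] (j k : n) :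
    ‖(Matrix.single j k (1 : ℂ))‖ ≤ 1 := by
  have h : ∀ k : n, ‖(Matrix.single k k (1 : ℂ))‖ ≤ 1 := fun k =>
    norm_le_one_of_projection (by
      rw [Matrix.star_eq_conjTranspose, Matrix.conjTranspose_single, star_one])
      (by rw [Matrix.single_mul_single_same, one_mul])
  have h1 := CStarRing.norm_star_mul_self (x := Matrix.single j k (1 : ℂ))
  rw [Matrix.star_eq_conjTranspose, Matrix.conjTranspose_single, star_one,
    Matrix.single_mul_single_same, one_mul] at h1
  nlinarith [h k, norm_nonneg (Matrix.single j k (1 : ℂ))]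

/-- The generators of an algebra of matrices that contains the diagonal matrices. -/
theorem hasGenerators_matrix {n : ℕ} {I : Type v} {s t : I → Fin n}
    {A : Subalgebra ℂ (Matrix (Fin n) (Fin n) ℂ)} (hdiag : ∀ k, Matrix.single k k 1 ∈ A)
    (hst : ∀ i, Matrix.single (s i) (t i) 1 ∈ A)
    (hA : A ≤ Algebra.adjoin ℂ (Set.range (Sum.elim (fun j => Matrix.single j j (1 : ℂ))
      fun i => Matrix.single (s i) (t i) 1))) :
    HasGenerators A s t (fun k => Matrix.single k k 1) fun i => Matrix.single (s i) (t i) 1 where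
  p_mem := hdiag
  l_mem := hst
  dense a ha := subset_closure (hA ha)
  mul_self k := by rw [Matrix.single_mul_single_same, one_mul]
  mul_of_ne k m h := Matrix.single_mul_single_of_ne _ _ _ _ h _
  norm_p_le k := norm_single_one_le k k
  sum_eq_one := by
    rw [Matrix.sum_single_eq_diagonal]
    exact Matrix.diagonal_one
  p_mul_l i := by rw [Matrix.single_mul_single_same, one_mul]
  l_mul_p i := by rw [Matrix.single_mul_single_same, one_mul]
  norm_l_le i := norm_single_one_le _ _

theorem hasGenerators_cornerAlg {n : ℕ} (i k : Fin n) :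
    HasGenerators (cornerAlg i k) (fun _ : Unit => i) (fun _ => k)
      (fun k => Matrix.single k k 1) fun _ => Matrix.single i k 1 :=
  hasGenerators_matrix (single_one_mem_cornerAlg i k) (fun _ => single_mem_cornerAlg i k 1)
    (cornerAlg_le_adjoin i k)

theorem hasGenerators_upperTri (n : ℕ) :
    HasGenerators (upperTri n) (fun k : Fin (n - 1) => ⟨k, by omega⟩)
      (fun k => ⟨k + 1, by omega⟩) (fun k => Matrix.single k k 1)
      fun k => Matrix.single ⟨k, by omega⟩ ⟨k + 1, by omega⟩ 1 :=
  hasGenerators_matrix (fun _ => single_mem_upperTri le_rfl)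
    (fun _ => single_mem_upperTri (Nat.le_succ _)) (upperTri_le_adjoin n)

/-! ### The generators of the algebra of the cycle -/

/-- The coordinate of `T v` at `s` is the inner product of `star T (unitVec s)` with `v`. The
adjoint form allows the same description of the generators to be used here and for the matrix
coefficients. -/
theorem clm_ext_star_unitVec {S : Type u} {T T' : lp (fun _ : S => ℂ) 2 →L[ℂ] lp (fun _ : S => ℂ) 2}
    (h : ∀ s, star T (unitVec s) = star T' (unitVec s)) : T = T' := by
  refine ContinuousLinearMap.ext fun v => lp.ext (funext fun s => ?_)
  have := h s
  rw [ContinuousLinearMap.star_eq_adjoint, ContinuousLinearMap.star_eq_adjoint] at this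
  rw [← inner_unitVec, ← inner_unitVec, ← ContinuousLinearMap.adjoint_inner_left, this,
    ContinuousLinearMap.adjoint_inner_left]

theorem norm_ell2Shift_le {K S : Type u} {f g : K → S} (hf : Function.Injective f)
    (hg : Function.Injective g) : ‖ell2Shift f g hf hg‖ ≤ 1 := by
  refine (ContinuousLinearMap.opNorm_comp_le _ _).trans ?_
  rw [LinearIsometryEquiv.norm_map]
  exact mul_le_one₀ (LinearIsometry.norm_toContinuousLinearMap_le _) (norm_nonneg _)
    (LinearIsometry.norm_toContinuousLinearMap_le _)

section Graph

variable {V : Type u} [Quiver.{u} V]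

open Classical in
theorem vertexProj_mul_vertexProj (a b : V) :
    vertexProj a * vertexProj b = if a = b then vertexProj a else 0 := by
  refine clm_ext_star_unitVec fun w => ?_
  rw [star_mul, star_vertexProj, star_vertexProj, mul_apply_eq_comp,
    vertexProj_unitVec]
  split_ifs with h1 h2 h2
  · rw [vertexProj_unitVec, if_pos (h1.trans h2), star_vertexProj, vertexProj_unitVec, if_pos h1]
  · rw [vertexProj_unitVec, if_neg (fun h => h2 (h1.symm.trans h)), star_zero]
    rfl
  · rw [map_zero, star_vertexProj, vertexProj_unitVec, if_neg h1]
  · rw [map_zero, star_zero]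
    rfl

theorem sum_vertexProj [Fintype V] : ∑ a : V, vertexProj a = 1 := by
  classical
  refine clm_ext_star_unitVec fun w => ?_
  rw [star_sum, star_one, sum_apply]
  simp [star_vertexProj, vertexProj_unitVec]

theorem vertexProj_mul_creation {a b : V} (e : a ⟶ b) :
    vertexProj a * creation e = creation e := by
  classical
  refine clm_ext_star_unitVec fun w => ?_
  rw [star_mul, star_vertexProj, mul_apply_eq_comp, vertexProj_unitVec]
  split_ifs with h
  · rfl
  · rw [map_zero, star_creation_of_notMem]
    rintro ⟨w', rfl⟩
    exact h rfl

theorem creation_mul_vertexProj {a b : V} (e : a ⟶ b) :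
    creation e * vertexProj b = creation e := by
  classical
  refine clm_ext_star_unitVec fun w => ?_
  rw [star_mul, star_vertexProj, mul_apply_eq_comp]
  by_cases h : w ∈ Set.range (prependEdge e)
  · obtain ⟨w', rfl⟩ := h
    rw [star_creation_prependEdge, vertexProj_unitVec]
    exact if_pos rfl
  · rw [star_creation_of_notMem e h, map_zero]

end Graph

theorem hasGenerators_graphAlg (n : ℕ) :
    HasGenerators (graphAlg (CycleGraph n)) (fun i : Fin n => i) cyc cycleProj
      cycleCreation where
  p_mem := cycleProj_mem
  l_mem := cycleCreation_mem
  dense := graphAlg_subset_closure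
  mul_self k := by
    exact (vertexProj_mul_vertexProj (V := CycleGraph n) k k).trans (if_pos rfl)
  mul_of_ne k m h := by
    exact (vertexProj_mul_vertexProj (V := CycleGraph n) k m).trans (if_neg h)
  norm_p_le _ := norm_ell2Shift_le _ _
  sum_eq_one := @sum_vertexProj (CycleGraph n) _ (inferInstanceAs (Fintype (Fin n)))
  p_mul_l i := vertexProj_mul_creation (cycleEdge i)
  l_mul_p i := creation_mul_vertexProj (cycleEdge i)
  norm_l_le _ := norm_ell2Shift_le _ _

/-! ### Free products of the algebras of matrices -/

theorem diagEmb_single {n : ℕ} (A : Subalgebra ℂ (Matrix (Fin n) (Fin n) ℂ))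
    (hA : ∀ d : Fin n → ℂ, Matrix.diagonal d ∈ A) (k : Fin n) (hk : Matrix.single k k 1 ∈ A) :
    diagEmb A hA (Pi.single k 1) = MaxCover.of A ⟨Matrix.single k k 1, hk⟩ :=
  congrArg (MaxCover.of A) (Subtype.ext (Matrix.diagonal_single k 1))

/-- It reduces agreement on the diagonal subalgebra to agreement on the diagonal matrix units. -/
theorem diagEmb_eq_sum {n : ℕ} (A : Subalgebra ℂ (Matrix (Fin n) (Fin n) ℂ))
    (hA : ∀ d : Fin n → ℂ, Matrix.diagonal d ∈ A) (hk : ∀ k, Matrix.single k k 1 ∈ A)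
    (d : Fin n → ℂ) :
    diagEmb A hA d = ∑ k, d k • MaxCover.of A ⟨Matrix.single k k 1, hk k⟩ := by
  have h : d = ∑ k, d k • (Pi.single k 1 : Fin n → ℂ) := by
    rw [← Finset.univ_sum_single d]
    simp [← Pi.single_smul]
  conv_lhs => rw [h, map_sum]
  refine Finset.sum_congr rfl fun k _ => ?_
  rw [map_smul, diagEmb_single A hA k (hk k)]

/-- If the completely contractive representations of `A` are given by the families of projections
and contractions which satisfy the relations of the generators of `A`, then the maximal C*-cover of
`A` is the free product of those of the algebras of matrices with one of the contractions. -/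
theorem exists_starAlgEquiv {n : ℕ} {I : Type} [Nonempty I] {s t : I → Fin n}
    (hst : ∀ i, s i ≠ t i) {M : Type} [CStarAlgebra M] {A : Subalgebra ℂ M} {p : Fin n → M}
    {l : I → M} (hA : HasGenerators A s t p l)
    (hrep : ∀ (X : Type) [NonUnitalCStarAlgebra X] (q : Fin n → X) (x : I → X), IsProjFamily q →
      (∀ i, q (s i) * x i = x i) → (∀ i, x i * q (t i) = x i) → (∀ i, ‖x i‖ ≤ 1) →
      ∃ ρ : A → X, IsCCRep A ρ ∧ (∀ k, ρ ⟨p k, hA.p_mem k⟩ = q k) ∧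
        ∀ i, ρ ⟨l i, hA.l_mem i⟩ = x i) :
    ∃ Φ : AmalgFreeProd (fun i : I => MaxCover (cornerAlg (s i) (t i)))
        (fun i => diagEmb (cornerAlg (s i) (t i)) (diagonal_mem_cornerAlg _ _)) ≃⋆ₐ[ℂ] MaxCover A,
      ∀ i, (∀ k, Φ (AmalgFreeProd.of _ i (MaxCover.of (cornerAlg (s i) (t i))
          ⟨Matrix.single k k 1, single_one_mem_cornerAlg _ _ k⟩)) =
            MaxCover.of A ⟨p k, hA.p_mem k⟩) ∧
        Φ (AmalgFreeProd.of _ i (MaxCover.of (cornerAlg (s i) (t i))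
          ⟨Matrix.single (s i) (t i) 1, single_mem_cornerAlg _ _ 1⟩)) =
            MaxCover.of A ⟨l i, hA.l_mem i⟩ := by
  obtain ⟨i₀⟩ := ‹Nonempty I›
  set δ := fun i : I => diagEmb (cornerAlg (s i) (t i)) (diagonal_mem_cornerAlg (s i) (t i))
    with hδ
  have hC := fun i : I => hasGenerators_cornerAlg (s i) (t i)
  have hofA := MaxCover.isCCRep_of A
  -- the homomorphism on the free product
  choose σ hσ hσp hσl using fun i : I => exists_isCCRep_cornerAlg (hst i) (hA.isProjFamily hofA)
    (hA.apply_p_mul_l hofA i) (hA.apply_l_mul_p hofA i) (hA.norm_apply_l_le hofA i)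
  choose φ hφ _ using fun i : I => MaxCover.existsUnique_lift (cornerAlg (s i) (t i)) (hσ i)
  have hφδ : ∀ i j d, φ i (δ i d) = φ j (δ j d) := by
    have h : ∀ i d, φ i (δ i d) = ∑ k, d k • MaxCover.of A ⟨p k, hA.p_mem k⟩ := by
      intro i d
      rw [hδ]
      simp only
      rw [diagEmb_eq_sum _ _ (single_one_mem_cornerAlg _ _), map_sum]
      refine Finset.sum_congr rfl fun k _ => ?_
      rw [map_smul, hφ, hσp]
    intro i j d
    rw [h, h]
  obtain ⟨Φ, hΦ, -⟩ := AmalgFreeProd.existsUnique_lift δ φ hφδ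
  -- the inverse
  have hof : ∀ i, IsCCRep (cornerAlg (s i) (t i)) fun a =>
      AmalgFreeProd.of δ i (MaxCover.of (cornerAlg (s i) (t i)) a) := fun i =>
    (MaxCover.isCCRep_of _).comp_hom (AmalgFreeProd.of δ i)
  have hamalg : ∀ i j k, AmalgFreeProd.of δ i (MaxCover.of (cornerAlg (s i) (t i))
      ⟨Matrix.single k k 1, single_one_mem_cornerAlg _ _ k⟩) =
      AmalgFreeProd.of δ j (MaxCover.of (cornerAlg (s j) (t j))
      ⟨Matrix.single k k 1, single_one_mem_cornerAlg _ _ k⟩) := by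
    intro i j k
    have := AmalgFreeProd.of_amalg δ i j (Pi.single k 1)
    rw [hδ] at this
    simp only at this
    rwa [diagEmb_single _ _ k (single_one_mem_cornerAlg _ _ k),
      diagEmb_single _ _ k (single_one_mem_cornerAlg _ _ k)] at this
  -- The projections are taken from the single factor `i₀`; by amalgamation they coincide with those
  -- of every other factor, so all the contractions satisfy the relations with respect to them.
  obtain ⟨ρ, hρ, hρp, hρl⟩ := hrep (AmalgFreeProd (fun i : I => MaxCover (cornerAlg (s i) (t i))) δ)
    (fun k => AmalgFreeProd.of δ i₀ (MaxCover.of (cornerAlg (s i₀) (t i₀))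
      ⟨Matrix.single k k 1, single_one_mem_cornerAlg _ _ k⟩))
    (fun i => AmalgFreeProd.of δ i (MaxCover.of (cornerAlg (s i) (t i))
      ⟨Matrix.single (s i) (t i) 1, single_mem_cornerAlg _ _ 1⟩))
    ((hC i₀).isProjFamily (hof i₀))
    (fun i => by
      rw [hamalg i₀ i]
      exact (hC i).apply_p_mul_l (hof i) ())
    (fun i => by
      rw [hamalg i₀ i]
      exact (hC i).apply_l_mul_p (hof i) ())
    (fun i => (hC i).norm_apply_l_le (hof i) ())
  obtain ⟨Ψ, hΨ, -⟩ := MaxCover.existsUnique_lift A hρ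
  -- Two *-homomorphisms on the cover of a factor agree once they agree on the generators of the
  -- matrix algebra, by `HasGenerators.ext` and uniqueness of lifts. The composite `Φ (Ψ x)` is
  -- treated alike below.
  have hΨφ : ∀ i c, Ψ (φ i c) = AmalgFreeProd.of δ i c := by
    intro i c
    obtain ⟨_, _, huniq⟩ := MaxCover.existsUnique_lift _ (hof i)
    have h1 : Ψ.comp (φ i) = AmalgFreeProd.of δ i := by
      refine (huniq _ fun a => ?_).trans (huniq _ fun a => rfl).symm
      refine (hC i).ext ((hσ i).comp_hom Ψ) (hof i) ?_ ?_ a |> Eq.trans ?_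
      · exact congrArg Ψ (hφ i a)
      · intro k
        rw [hσp, hΨ, hρp, hamalg i₀ i]
      · intro _
        rw [hσl, hΨ, hρl]
    exact DFunLike.congr_fun h1 c
  have hΨΦ : ∀ x, Ψ (Φ x) = x := by
    intro x
    obtain ⟨_, _, huniq⟩ := AmalgFreeProd.existsUnique_lift δ (fun i => AmalgFreeProd.of δ i)
      (AmalgFreeProd.of_amalg δ)
    have h1 : Ψ.comp Φ = NonUnitalStarAlgHom.id ℂ _ := by
      refine (huniq _ fun i c => ?_).trans (huniq _ fun i c => rfl).symm
      exact (congrArg Ψ (hΦ i c)).trans (hΨφ i c)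
    exact DFunLike.congr_fun h1 x
  have hΦΨ : ∀ x, Φ (Ψ x) = x := by
    intro x
    obtain ⟨_, _, huniq⟩ := MaxCover.existsUnique_lift A hofA
    have h1 : Φ.comp Ψ = NonUnitalStarAlgHom.id ℂ _ := by
      refine (huniq _ fun a => ?_).trans (huniq _ fun a => rfl).symm
      refine hA.ext (hρ.comp_hom Φ) hofA ?_ ?_ a |> Eq.trans ?_
      · exact congrArg Φ (hΨ a)
      · intro k
        rw [hρp, hΦ, hφ, hσp]
      · intro i
        rw [hρl, hΦ, hφ, hσl]
    exact DFunLike.congr_fun h1 x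
  refine ⟨StarAlgEquiv.ofBijective Φ
    ⟨Function.LeftInverse.injective hΨΦ, Function.RightInverse.surjective hΦΨ⟩, fun i => ⟨?_, ?_⟩⟩
  · intro k
    refine (hΦ i _).trans ?_
    rw [hφ, hσp]
  · refine (hΦ i _).trans ?_
    rw [hφ, hσl]

theorem theorem3p3 (n : ℕ) :
    (3 ≤ n →
      ∃ Φ : AmalgFreeProd (fun i : Fin (n - 1) => MaxCover (stepAlg n i))
          (fun i => diagEmb (stepAlg n i) (diagonal_mem_cornerAlg _ _)) ≃⋆ₐ[ℂ]
        MaxCover (upperTri n),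
      ∀ (i : Fin (n - 1)) (a : stepAlg n i),
        Φ (AmalgFreeProd.of _ i (MaxCover.of (stepAlg n i) a)) =
          MaxCover.of (upperTri n) ⟨a, stepAlg_le_upperTri n i a.2⟩) ∧
    (2 ≤ n →
      ∃ Φ : AmalgFreeProd (fun i : Fin n => MaxCover (cycleStepAlg n i))
          (fun i => diagEmb (cycleStepAlg n i) (diagonal_mem_cornerAlg _ _)) ≃⋆ₐ[ℂ]
        MaxCover (graphAlg (CycleGraph n)),
      ∀ i : Fin n,
        (∀ k : Fin n,
          Φ (AmalgFreeProd.of _ i (MaxCover.of (cycleStepAlg n i)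
            ⟨Matrix.diagonal (Pi.single k 1), diagonal_mem_cornerAlg _ _ _⟩)) =
          MaxCover.of (graphAlg (CycleGraph n))
            ⟨vertexProj (V := CycleGraph n) k, vertexProj_mem _⟩) ∧
        Φ (AmalgFreeProd.of _ i (MaxCover.of (cycleStepAlg n i)
            ⟨Matrix.single i (cyc i) 1, single_mem_cornerAlg _ _ _⟩)) =
          MaxCover.of (graphAlg (CycleGraph n)) ⟨creation (cycleEdge i), creation_mem _⟩) := by
  refine ⟨fun hn => ?_, fun hn => ?_⟩
  · have : Nonempty (Fin (n - 1)) := ⟨⟨0, by omega⟩⟩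
    obtain ⟨Φ, hΦ⟩ := exists_starAlgEquiv (I := Fin (n - 1))
      (fun i h => by simp [Fin.ext_iff] at h) (hasGenerators_upperTri n)
      (fun X _ q x hq hqx hxq hx => exists_isCCRep_upperTri hq hqx hxq hx (by omega))
    refine ⟨Φ, fun i a => ?_⟩
    -- Equality on all of `stepAlg n i` follows from equality on its generators, both sides being
    -- completely contractive representations.
    have h1 := (MaxCover.isCCRep_of (stepAlg n i)).comp_hom
      (AmalgFreeProd.of (fun i => diagEmb (stepAlg n i) (diagonal_mem_cornerAlg _ _)) i)
    have h2 := h1.comp_hom Φ.toNonUnitalStarAlgHom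
    exact (hasGenerators_cornerAlg _ _).ext h2
      ((MaxCover.isCCRep_of (upperTri n)).restrict (stepAlg_le_upperTri n i))
      (hΦ i).1 (fun _ => (hΦ i).2) a
  · have : NeZero n := ⟨by omega⟩
    -- This is where `2 ≤ n` enters: a loop would make the corner algebra diagonal, with no room for
    -- a free contraction.
    have hcyc : ∀ i : Fin n, i ≠ cyc i := by
      intro i h
      have h1 : (i : ℕ) = (i + 1) % n := congrArg Fin.val h
      rcases Nat.lt_or_ge ((i : ℕ) + 1) n with h2 | h2
      · rw [Nat.mod_eq_of_lt h2] at h1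
        omega
      · have h3 : (i : ℕ) + 1 = n := by omega
        rw [h3, Nat.mod_self] at h1
        omega
    obtain ⟨Φ, hΦ⟩ := exists_starAlgEquiv hcyc (hasGenerators_graphAlg n)
      (fun X _ q x hq hqx hxq hx => exists_isCCRep_cycle hq hqx hxq hx)
    refine ⟨Φ, fun i => ⟨fun k => ?_, (hΦ i).2⟩⟩
    refine Eq.trans (congrArg (fun a => Φ (AmalgFreeProd.of _ i (MaxCover.of (cycleStepAlg n i) a)))
      (Subtype.ext (Matrix.diagonal_single k 1))) ((hΦ i).1 k)
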